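/- **Theorem 2.** Let $V=\{1,\dots,p\}$ and $\alpha(i)\ge 2$ for $i\in V$. Let $Y_k=(Y_k^{(1)},\dots,Y_k^{(p)})\in\{0,1\}^p$, $k=1,2,\dots$, be a stationary ergodic source, and let $X_k=(X_k^{(1)},\dots,X_k^{(p)})$ be random vectors with $X_k^{(i)}\in\{0,\dots,\alpha(i)-1\}$ if $Y_k^{(i)}=1$ and $X_k^{(i)}=\alpha(i)$ ("missing") if $Y_k^{(i)}=0$. Assume that, given the sequence $Y$, the $X_k$ are independent and the law of $X_k$ depends only on $Y_k$, in the same way for all $k$. Write $(X,Y)$ for a generic $(X_k,Y_k)$. Let $r(i)=P(Y^{(i)}=1)$, $r(i,j)=P(Y^{(i)}=Y^{(j)}=1)$; let $P_i$ be the law of $X^{(i)}$ given $Y^{(i)}=1$, with entropy $H(i)$, and $P_{ij}$ the law of $(X^{(i)},X^{(j)})$ given $Y^{(i)}=Y^{(j)}=1$, with mutual information $I(i,j)$. For weights $w(i,j)=w(j,i)$, the Chow–Liu algorithm examines all pairs $\{i,j\}$, $i\ne j$, in an order of non-increasing weight (ties broken arbitrarily) and connects a pair if its weight is positive and no loop is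 created. Let $E_{X|Y}$ be an edge set obtained by applying it to $\{r(i,j)I(i,j)\}$. Assume that for each $i\in V$ the law of $X^{(i)}$ given $Y=y$ is the same for all $y$ with $y_i=1$ and $P(Y=y)>0$, and that for each $\{i,j\}\in E_{X|Y}$ the law of $(X^{(i)},X^{(j)})$ given $Y=y$ is the same for all $y$ with $y_i=y_j=1$ and $P(Y=y)>0$ (as is the case if values are missing independently of the data). Put $$P'_{X|Y}(x|y)=\prod_{i\in V}P_i(x_i)^{y_i}\prod_{\{i,j\}\in E_{X|Y}}\Big\{\frac{P_{ij}(x_i,x_j)}{P_i(x_i)P_j(x_j)}\Big\}^{y_iy_j},\qquad H(X|Y)=-\sum_yP(Y=y)\sum_xP'_{X|Y}(x|y)\log P'_{X|Y}(x|y),$$ where $x$ ranges over the samples whose missing entries are exactly those with $y_i=0$. For a data frame $X_1,\dots,X_n$, let $[i]$ and $[i,j]$ be the sets of $k\le n$ for which entry $i$, respectively both entries $i$ and $j$, are not missing, and $n(i)$, $n(i,j)$ their cardinalities. For a sequence over an alphabet $A$ in which $a\in A$ occurs $c(a)$ times, the Bayes measure is $$\frac{\Gamma(|A|/2)}{\Gamma\big(\sum_{a}(c(a)+\frac12)\big)}\prod_{a\in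 A}\frac{\Gamma(c(a)+\frac12)}{\Gamma(\frac12)}.$$ Let $Q^n(i)$, $Q^n_j(i)$, $Q^n(i,j)$ be the Bayes measures of $\{X_k^{(i)}\}_{k\in[i]}$, $\{X_k^{(i)}\}_{k\in[i,j]}$, $\{(X_k^{(i)},X_k^{(j)})\}_{k\in[i,j]}$, and let $$J^n(i,j)=\frac1n\log\frac{Q^n(i,j)}{Q^n_j(i)Q^n_i(j)},\qquad R^n(E)=\prod_{i\in V}Q^n(i)\prod_{\{i,j\}\in E}\frac{Q^n(i,j)}{Q^n_j(i)Q^n_i(j)}.$$ Let $E'$ be an edge set obtained by applying the Chow–Liu algorithm to $\{J^n(i,j)\}$, and let $L=\log F_p-\log R^n(E')$ be the description length based on it, where $F_p$ is the number of forests on $V$. Then $$H(X|Y)=\sum_{i\in V}r(i)H(i)-\sum_{\{i,j\}\in E_{X|Y}}r(i,j)I(i,j),$$ and the per-sample redundancy satisfies, for all $n\ge1$, $$\frac{EL}{n}-H(X|Y)\le\sum_{i\in V}\frac{\alpha(i)-1}{2n}E\log n(i)+\sum_{\{i,j\}\in E_{X|Y}}\frac{(\alpha(i)-1)(\alpha(j)-1)}{2n}E\log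 n(i,j)+O(1/n),$$ where the constant in $O(1/n)$ does not depend on $n$, and $\log 0$ is read as $0$. -/

import Mathlib

open MeasureTheory ProbabilityTheory

namespace ForestCoding

/-! ### Forests and the Chow–Liu (Kruskal) procedure

The vertex set is `Fin p`; an undirected edge `{i, j}` is represented by the pair `(i, j)` with
`i < j`. -/

/-- The undirected graph on `Fin p` whose edge set is `E`. -/
def graphOf {p : ℕ} (E : Finset (Fin p × Fin p)) : SimpleGraph (Fin p) :=
  SimpleGraph.fromRel fun i j => (i, j) ∈ E

/-- `E` is the edge set of a forest. -/
def IsForest {p : ℕ} (E : Finset (Fin p × Fin p)) : Prop :=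
  (∀ e ∈ E, e.1 < e.2) ∧ (graphOf E).IsAcyclic

open Classical in
/-- One step of the procedure: the pair `e` is connected if its weight is positive and
connecting it creates no loop. -/
noncomputable def kruskalStep {p : ℕ} (w : Fin p → Fin p → ℝ)
    (E : Finset (Fin p × Fin p)) (e : Fin p × Fin p) : Finset (Fin p × Fin p) :=
  if 0 < w e.1 e.2 ∧ (graphOf (insert e E)).IsAcyclic then insert e E else E

/-- `E` is an edge set obtained by applying the Chow–Liu algorithm to the weights `w`: all pairs
are examined once, in an order of non-increasing weight (ties are broken arbitrarily). -/
def IsChowLiu {p : ℕ} (w : Fin p → Fin p → ℝ) (E : Finset (Fin p × Fin p)) : Prop :=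
  ∃ l : List (Fin p × Fin p), l.Nodup ∧ (∀ e, e ∈ l ↔ e.1 < e.2) ∧
    l.Pairwise (fun e f => w f.1 f.2 ≤ w e.1 e.2) ∧ E = l.foldl (kruskalStep w) ∅

open Classical in
/-- The number of forests with vertex set `Fin p`. -/
noncomputable def numForests (p : ℕ) : ℕ :=
  (Finset.univ.filter fun E : Finset (Fin p × Fin p) => IsForest E).card

/-! ### Data frames with missing values, Bayes measures and the description length -/

/-- A sample of the `p` variables: the `i`-th entry is one of the values `0, …, α i - 1`, or
`α i` (that is, `Fin.last (α i)`), which means that the entry is missing. -/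
abbrev Row {p : ℕ} (α : Fin p → ℕ) : Type := (i : Fin p) → Fin (α i + 1)

section Frame

variable {p : ℕ} {α : Fin p → ℕ} {n : ℕ}

/-- `[i]`: the samples in which entry `i` is not missing. -/
def obs (x : Fin n → Row α) (i : Fin p) : Finset (Fin n) :=
  Finset.univ.filter fun k => x k i ≠ Fin.last (α i)

/-- `[i,j]`: the samples in which neither entry `i` nor entry `j` is missing. -/
def obs₂ (x : Fin n → Row α) (i j : Fin p) : Finset (Fin n) :=
  Finset.univ.filter fun k => x k i ≠ Fin.last (α i) ∧ x k j ≠ Fin.last (α j)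

/-- The Bayes measure with all prior parameters equal to `1/2` of a sequence over the finite
alphabet `A` in which each `a` occurs `c a` times. -/
noncomputable def bayesMeasure {A : Type*} [Fintype A] (c : A → ℕ) : ℝ :=
  Real.Gamma ((Fintype.card A : ℝ) / 2) / Real.Gamma (∑ a, ((c a : ℝ) + 1 / 2)) *
    ∏ a, (Real.Gamma ((c a : ℝ) + 1 / 2) / Real.Gamma (1 / 2))

/-- `Qⁿ(i)`: Bayes measure of the `i`-th entries over `[i]`. -/
noncomputable def Q (x : Fin n → Row α) (i : Fin p) : ℝ :=
  bayesMeasure fun a : Fin (α i) => ((obs x i).filter fun k => x k i = a.castSucc).card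

/-- `Qⁿ_j(i)`: Bayes measure of the `i`-th entries over `[i,j]`. -/
noncomputable def Qsub (x : Fin n → Row α) (i j : Fin p) : ℝ :=
  bayesMeasure fun a : Fin (α i) => ((obs₂ x i j).filter fun k => x k i = a.castSucc).card

/-- `Qⁿ(i,j)`: Bayes measure of the pairs of `i`-th and `j`-th entries over `[i,j]`. -/
noncomputable def Qpair (x : Fin n → Row α) (i j : Fin p) : ℝ :=
  bayesMeasure fun ab : Fin (α i) × Fin (α j) =>
    ((obs₂ x i j).filter fun k => x k i = ab.1.castSucc ∧ x k j = ab.2.castSucc).card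

/-- `Jⁿ(i,j)`. -/
noncomputable def J (x : Fin n → Row α) (i j : Fin p) : ℝ :=
  1 / (n : ℝ) * Real.log (Qpair x i j / (Qsub x i j * Qsub x j i))

/-- `Rⁿ(E)`: Bayes measure of the data frame with respect to the forest `E`. -/
noncomputable def R (x : Fin n → Row α) (E : Finset (Fin p × Fin p)) : ℝ :=
  (∏ i, Q x i) * ∏ e ∈ E, Qpair x e.1 e.2 / (Qsub x e.1 e.2 * Qsub x e.2 e.1)

/-- Description length (in nats) of the data frame through the forest `E`, under the uniform prior
over the forests: `log (number of forests)` for the forest, `-log Rⁿ(E)` for the data. -/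
noncomputable def descriptionLength (x : Fin n → Row α) (E : Finset (Fin p × Fin p)) : ℝ :=
  Real.log (numForests p) - Real.log (R x E)

end Frame

/-! ### The source -/

section Source

variable {p : ℕ} {α : Fin p → ℕ} {Ω : Type*} [MeasurableSpace Ω]

/-- `Y` is a stationary ergodic source of indicators (`true` = observed) and `X` a data source
whose missing entries are those indicated by `Y`. Given the sequence `Y`, the samples `X k` are
independent, and the law of `X k` is determined by `Y k`, in the same way for all `k`. -/
structure IsIncompleteSource (μ : Measure Ω) (X : ℕ → Ω → Row α)
    (Y : ℕ → Ω → Fin p → Bool) : Prop where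
  measurable_X : ∀ k, Measurable (X k)
  measurable_Y : ∀ k, Measurable (Y k)
  missing_iff : ∀ k ω i, X k ω i = Fin.last (α i) ↔ Y k ω i = false
  ergodic : Ergodic (fun (y : ℕ → Fin p → Bool) (k : ℕ) => y (k + 1))
    (μ.map fun ω k => Y k ω)
  memoryless : ∀ (n : ℕ) (x : Fin n → Row α) (y : Fin n → Fin p → Bool),
    μ.real {ω | ∀ k : Fin n, X k ω = x k ∧ Y k ω = y k} =
      μ.real {ω | ∀ k : Fin n, Y k ω = y k} *
        ∏ k : Fin n, (μ[|{ω | Y 0 ω = y k}]).real {ω | X 0 ω = x k}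

variable (μ : Measure Ω) (X : ℕ → Ω → Row α) (Y : ℕ → Ω → Fin p → Bool)

/-- `r(i)`: probability that entry `i` is observed. -/
noncomputable def r (i : Fin p) : ℝ := μ.real {ω | Y 0 ω i = true}

/-- `r(i,j)`: probability that entries `i` and `j` are both observed. -/
noncomputable def r₂ (i j : Fin p) : ℝ := μ.real {ω | Y 0 ω i = true ∧ Y 0 ω j = true}

/-- `P(X⁽ⁱ⁾ = a)`, the law of entry `i` given that it is observed. -/
noncomputable def P (i : Fin p) (a : Fin (α i + 1)) : ℝ :=
  (μ[|{ω | Y 0 ω i = true}]).real {ω | X 0 ω i = a}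

/-- The law of entry `i` given that entries `i` and `j` are both observed. -/
noncomputable def Psub (i j : Fin p) (a : Fin (α i + 1)) : ℝ :=
  (μ[|{ω | Y 0 ω i = true ∧ Y 0 ω j = true}]).real {ω | X 0 ω i = a}

/-- `P(X⁽ⁱ⁾ = a, X⁽ʲ⁾ = b)`, the law of entries `i`, `j` given that both are observed. -/
noncomputable def P₂ (i j : Fin p) (a : Fin (α i + 1)) (b : Fin (α j + 1)) : ℝ :=
  (μ[|{ω | Y 0 ω i = true ∧ Y 0 ω j = true}]).real {ω | X 0 ω i = a ∧ X 0 ω j = b}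

/-- The law of entries `i` and `j`, when both are observed, does not depend on which of the other
entries are observed. For `i = j` this is a condition on the law of the single entry `i`. -/
def PatternFree (i j : Fin p) : Prop :=
  ∀ y : Fin p → Bool, y i = true → y j = true → μ {ω | Y 0 ω = y} ≠ 0 →
    ∀ (a : Fin (α i + 1)) (b : Fin (α j + 1)),
      (μ[|{ω | Y 0 ω = y}]).real {ω | X 0 ω i = a ∧ X 0 ω j = b} = P₂ μ X Y i j a b

/-- `H(i)`: entropy of the observed entry `i`. -/
noncomputable def H (i : Fin p) : ℝ := ∑ a, Real.negMulLog (P μ X Y i a)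

/-- `I(i,j)`: mutual information of entries `i` and `j` when both are observed. -/
noncomputable def I (i j : Fin p) : ℝ :=
  ∑ a, ∑ b, P₂ μ X Y i j a b *
    Real.log (P₂ μ X Y i j a b / (Psub μ X Y i j a * Psub μ X Y j i b))

/-- The forest distribution `P'(x | y)` of a sample given its missingness pattern. -/
noncomputable def P' (E : Finset (Fin p × Fin p)) (x : Row α) (y : Fin p → Bool) : ℝ :=
  (∏ i, P μ X Y i (x i) ^ (y i).toNat) *
    ∏ e ∈ E, (P₂ μ X Y e.1 e.2 (x e.1) (x e.2) /
      (P μ X Y e.1 (x e.1) * P μ X Y e.2 (x e.2))) ^ ((y e.1).toNat * (y e.2).toNat)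

open Classical in
/-- `H(X|Y)`: the conditional entropy of `P'` given the missingness pattern. The inner sum is over
the samples whose missing entries are those indicated by `y`. -/
noncomputable def condEntropy (E : Finset (Fin p × Fin p)) : ℝ :=
  ∑ y : Fin p → Bool, μ.real {ω | Y 0 ω = y} *
    ∑ x ∈ Finset.univ.filter (fun x : Row α => ∀ i, x i = Fin.last (α i) ↔ y i = false),
      Real.negMulLog (P' μ X Y E x y)

/-- The data frame of the first `n` samples. -/
def frame (n : ℕ) (ω : Ω) : Fin n → Row α := fun k => X k ω

end Source

end ForestCoding

namespace ForestCoding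

/-! ### Optimality of the Chow–Liu procedure -/

section Kruskal

variable {p : ℕ}

theorem graphOf_adj {E : Finset (Fin p × Fin p)} {a b : Fin p} :
    (graphOf E).Adj a b ↔ a ≠ b ∧ ((a, b) ∈ E ∨ (b, a) ∈ E) := by
  simp [graphOf, SimpleGraph.fromRel_adj]

theorem graphOf_mono {E F : Finset (Fin p × Fin p)} (h : E ⊆ F) : graphOf E ≤ graphOf F := by
  intro a b hab
  rw [graphOf_adj] at hab ⊢
  exact ⟨hab.1, hab.2.imp (fun h' => h h') (fun h' => h h')⟩

theorem graphOf_insert (e : Fin p × Fin p) (E : Finset (Fin p × Fin p)) :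
    graphOf (insert e E) = graphOf E ⊔ SimpleGraph.edge e.1 e.2 := by
  ext a b
  obtain ⟨i, j⟩ := e
  simp only [SimpleGraph.sup_adj, graphOf_adj, SimpleGraph.edge_adj, Finset.mem_insert,
    Prod.mk.injEq]
  tauto

theorem graphOf_empty : graphOf (∅ : Finset (Fin p × Fin p)) = ⊥ := by
  ext a b
  simp [graphOf_adj]

theorem IsForest.empty : IsForest (∅ : Finset (Fin p × Fin p)) := by
  refine ⟨by simp, ?_⟩
  rw [graphOf_empty]
  exact SimpleGraph.isAcyclic_bot

theorem IsForest.subset {E F : Finset (Fin p × Fin p)} (hF : IsForest F) (h : E ⊆ F) :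
    IsForest E :=
  ⟨fun e he => hF.1 e (h he), hF.2.anti (graphOf_mono h)⟩

/-- The endpoints of an edge of a forest are separated by the other edges. -/
theorem IsForest.not_reachable_of_insert {E : Finset (Fin p × Fin p)} {e : Fin p × Fin p}
    (h : IsForest (insert e E)) (he : e ∉ E) : ¬ (graphOf E).Reachable e.1 e.2 := by
  have hlt := h.1 e (Finset.mem_insert_self _ _)
  have hac := h.2
  rw [graphOf_insert, SimpleGraph.isAcyclic_sup_fromEdgeSet_iff] at hac
  intro hr
  rcases hac.2 hr with h1 | h1
  · exact hlt.ne h1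
  · rcases (graphOf_adj.1 h1).2 with h2 | h2
    · exact he h2
    · exact absurd (h.1 _ (Finset.mem_insert_of_mem h2)) (not_lt.2 hlt.le)

theorem IsForest.insert_of_not_reachable {E : Finset (Fin p × Fin p)} {e : Fin p × Fin p}
    (h : IsForest E) (hlt : e.1 < e.2) (hr : ¬ (graphOf E).Reachable e.1 e.2) :
    IsForest (insert e E) := by
  refine ⟨fun f hf => ?_, ?_⟩
  · rcases Finset.mem_insert.1 hf with rfl | hf
    exacts [hlt, h.1 f hf]
  · rw [graphOf_insert]
    exact h.2.sup_edge_of_not_reachable hr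

/-- Exchange property: if the edge `e` extends the forest `E` but not the larger forest `F`, then
it may replace an edge of `F` outside `E`. -/
theorem IsForest.exists_exchange {E F : Finset (Fin p × Fin p)} {e : Fin p × Fin p}
    (hF : IsForest F) (hEe : IsForest (insert e E)) (hEF : E ⊆ F) (heF : e ∉ F)
    (hFe : ¬ IsForest (insert e F)) :
    ∃ f ∈ F, f ∉ E ∧ IsForest (insert e (F.erase f)) := by
  classical
  have hlt := hEe.1 e (Finset.mem_insert_self _ _)
  have hnr := hEe.not_reachable_of_insert (fun h => heF (hEF h))
  have hr : (graphOf F).Reachable e.1 e.2 := by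
    by_contra hr
    exact hFe (hF.insert_of_not_reachable hlt hr)
  obtain ⟨w, hw⟩ := hr.exists_isPath
  -- The endpoints of `e` are not connected in `E`, so the path in `F` must use an edge outside `E`.
  obtain ⟨s, hs, hsE⟩ : ∃ s ∈ w.edges, s ∉ (graphOf E).edgeSet := by
    by_contra! hall
    exact hnr ⟨w.transfer _ hall⟩
  have key : ∃ f ∈ F, s = s(f.1, f.2) := by
    have hsF := w.edges_subset_edgeSet hs
    induction s with
    | h a b =>
      rcases (graphOf_adj.1 hsF).2 with h | h
      exacts [⟨_, h, rfl⟩, ⟨_, h, Sym2.eq_swap⟩]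
  obtain ⟨f, hf, rfl⟩ := key
  refine ⟨f, hf, fun hfE => hsE ?_, ?_⟩
  · exact graphOf_adj.2 ⟨(hF.1 f hf).ne, Or.inl hfE⟩
  · refine (hF.subset (Finset.erase_subset _ _)).insert_of_not_reachable hlt fun hr' => ?_
    -- A path avoiding `f` would be a second path in the acyclic graph of `F`; it must equal `w`,
    -- which uses `f`.
    obtain ⟨q, hq⟩ := hr'.exists_isPath
    have hle := graphOf_mono (Finset.erase_subset f F)
    have := (hF.2.subsingleton_path _ _).elim ⟨w, hw⟩ ⟨q.mapLe hle, hq.mapLe hle⟩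
    have hwq : w = q.mapLe hle := congrArg Subtype.val this
    rw [hwq, SimpleGraph.Walk.edges_mapLe_eq_edges] at hs
    have hadj := q.edges_subset_edgeSet hs
    have h2 := (graphOf_adj.1 hadj).2
    rcases h2 with h2 | h2
    · simp at h2
    · exact absurd (hF.1 _ (Finset.mem_of_mem_erase h2)) (not_lt.2 (hF.1 f hf).le)

theorem foldl_kruskalStep_isForest (w : Fin p → Fin p → ℝ) (l : List (Fin p × Fin p)) :
    ∀ E : Finset (Fin p × Fin p), IsForest E → (∀ e ∈ l, e.1 < e.2) →
      IsForest (l.foldl (kruskalStep w) E) := by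
  induction l with
  | nil => intro E hE _; exact hE
  | cons e l ih =>
    intro E hE hl
    refine ih _ ?_ fun f hf => hl f (List.mem_cons_of_mem _ hf)
    rw [kruskalStep]
    split_ifs with h
    · refine ⟨fun f hf => ?_, h.2⟩
      rcases Finset.mem_insert.1 hf with rfl | hf
      exacts [hl _ List.mem_cons_self, hE.1 f hf]
    · exact hE

theorem IsChowLiu.isForest {w : Fin p → Fin p → ℝ} {E : Finset (Fin p × Fin p)}
    (h : IsChowLiu w E) : IsForest E := by
  obtain ⟨l, -, hl, -, rfl⟩ := h
  exact foldl_kruskalStep_isForest w l ∅ IsForest.empty fun e he => (hl e).1 he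

/-- Induction with a moving competitor: `F` contains the current greedy set `E`, and its other edges
are still to be examined. Each step alters `F` without lowering its weight so that this persists; at
the end `F = E`. -/
theorem sum_le_sum_foldl_kruskalStep (w : Fin p → Fin p → ℝ) (l : List (Fin p × Fin p)) :
    ∀ E F : Finset (Fin p × Fin p), IsForest F → E ⊆ F → (∀ f ∈ F, f ∈ E ∨ f ∈ l) →
      (∀ e ∈ l, e.1 < e.2) → l.Pairwise (fun e f => w f.1 f.2 ≤ w e.1 e.2) →
      ∑ e ∈ F, w e.1 e.2 ≤ ∑ e ∈ l.foldl (kruskalStep w) E, w e.1 e.2 := by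
  classical
  induction l with
  | nil =>
    intro E F _ hEF hFE _ _
    have : F = E := Finset.Subset.antisymm (fun f hf => by simpa using hFE f hf) hEF
    simp [this]
  | cons e l ih =>
    intro E F hF hEF hFE hl hs
    have hl' : ∀ f ∈ l, f.1 < f.2 := fun f hf => hl f (List.mem_cons_of_mem _ hf)
    obtain ⟨hs1, hs2⟩ := List.pairwise_cons.1 hs
    rw [List.foldl_cons, kruskalStep]
    split_ifs with h
    · have hE' : IsForest (insert e E) := by
        refine ⟨fun f hf => ?_, h.2⟩
        rcases Finset.mem_insert.1 hf with rfl | hf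
        exacts [hl _ List.mem_cons_self, hF.1 f (hEF hf)]
      by_cases heF : e ∈ F
      · refine ih _ F hF (Finset.insert_subset heF hEF) (fun f hf => ?_) hl' hs2
        have := hFE f hf
        simp only [List.mem_cons, Finset.mem_insert] at this ⊢
        tauto
      · by_cases hFe : IsForest (insert e F)
        · refine le_trans ?_ (ih _ (insert e F) hFe (Finset.insert_subset_insert _ hEF)
            (fun f hf => ?_) hl' hs2)
          · rw [Finset.sum_insert heF]
            linarith [h.1]
          · rcases Finset.mem_insert.1 hf with rfl | hf
            · exact Or.inl (Finset.mem_insert_self _ _)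
            · have := hFE f hf
              simp only [List.mem_cons, Finset.mem_insert] at this ⊢
              tauto
        -- The edge `f` given up for `e` is still in the list, hence is no heavier than `e`.
        · obtain ⟨f, hf, hfE, hFf⟩ := hF.exists_exchange hE' hEF heF hFe
          refine le_trans ?_ (ih _ (insert e (F.erase f)) hFf
            (Finset.insert_subset_insert _ fun g hg => ?_) (fun g hg => ?_) hl' hs2)
          · rw [Finset.sum_insert (fun h' => heF (Finset.mem_of_mem_erase h')),
              ← Finset.add_sum_erase F _ hf]
            have hfl : f ∈ l := by
              have := hFE f hf
              simp only [List.mem_cons] at this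
              rcases this with h' | rfl | h'
              exacts [absurd h' hfE, absurd hf heF, h']
            linarith [hs1 f hfl]
          · exact Finset.mem_erase.2 ⟨fun h' => hfE (h' ▸ hg), hEF hg⟩
          · rcases Finset.mem_insert.1 hg with rfl | hg
            · exact Or.inl (Finset.mem_insert_self _ _)
            · have := hFE g (Finset.mem_of_mem_erase hg)
              simp only [List.mem_cons, Finset.mem_insert] at this ⊢
              tauto
    · by_cases heF : e ∈ F
      -- Within the forest `F` the edge `e` closes no loop with `E`, so it was rejected for its
      -- weight and can be dropped from `F`.
      · have hw : w e.1 e.2 ≤ 0 := by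
          by_contra hw
          exact h ⟨not_le.1 hw, (hF.subset (Finset.insert_subset heF hEF)).2⟩
        by_cases heE : e ∈ E
        · refine ih _ F hF hEF (fun f hf => ?_) hl' hs2
          have := hFE f hf
          simp only [List.mem_cons] at this
          rcases this with h' | rfl | h'
          exacts [Or.inl h', Or.inl heE, Or.inr h']
        · refine le_trans ?_ (ih _ (F.erase e) (hF.subset (Finset.erase_subset _ _))
            (fun g hg => Finset.mem_erase.2 ⟨fun h' => heE (h' ▸ hg), hEF hg⟩)
            (fun g hg => ?_) hl' hs2)
          · rw [← Finset.add_sum_erase F _ heF]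
            linarith
          · have := hFE g (Finset.mem_of_mem_erase hg)
            simp only [List.mem_cons] at this
            have := Finset.ne_of_mem_erase hg
            tauto
      · refine ih _ F hF hEF (fun f hf => ?_) hl' hs2
        have := hFE f hf
        simp only [List.mem_cons] at this
        rcases this with hfE | rfl | hfl
        exacts [Or.inl hfE, absurd hf heF, Or.inr hfl]

/-- The Chow–Liu procedure yields a forest of maximal weight. -/
theorem IsChowLiu.sum_le {w : Fin p → Fin p → ℝ} {E F : Finset (Fin p × Fin p)}
    (h : IsChowLiu w E) (hF : IsForest F) :
    ∑ e ∈ F, w e.1 e.2 ≤ ∑ e ∈ E, w e.1 e.2 := by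
  obtain ⟨l, -, hl, hs, rfl⟩ := h
  exact sum_le_sum_foldl_kruskalStep w l ∅ F hF (Finset.empty_subset _)
    (fun f hf => Or.inr ((hl f).2 (hF.1 f hf))) (fun e he => (hl e).1 he) hs

end Kruskal

/-! ### Forest distributions: marginals and entropy -/

section ForestWeight

variable {p : ℕ} {S : Fin p → Type*}

/-- The product of the vertex weights `m` and, over the edges in `D`, the edge weights `g`. -/
noncomputable def forestWeight (m : ∀ i, S i → ℝ) (g : ∀ e : Fin p × Fin p, S e.1 → S e.2 → ℝ)
    (D : Finset (Fin p × Fin p)) (x : ∀ i, S i) : ℝ :=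
  (∏ i, m i (x i)) * ∏ e ∈ D, g e (x e.1) (x e.2)

variable {m : ∀ i, S i → ℝ} {g : ∀ e : Fin p × Fin p, S e.1 → S e.2 → ℝ}

theorem forestWeight_eq_zero {D : Finset (Fin p × Fin p)} {x : ∀ i, S i} {i : Fin p}
    (h : m i (x i) = 0) : forestWeight m g D x = 0 := by
  rw [forestWeight, Finset.prod_eq_zero (Finset.mem_univ i) h, zero_mul]

theorem forestWeight_insert {D : Finset (Fin p × Fin p)} {e : Fin p × Fin p} (he : e ∉ D)
    (x : ∀ i, S i) :
    forestWeight m g (insert e D) x = forestWeight m g D x * g e (x e.1) (x e.2) := by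
  rw [forestWeight, forestWeight, Finset.prod_insert he]
  ring

variable [∀ i, Fintype (S i)]

theorem sum_prod_weight_eq_one (hm : ∀ i, ∑ a, m i a = 1) :
    ∑ x : ∀ i, S i, ∏ i, m i (x i) = 1 := by
  classical
  rw [← Fintype.piFinset_univ, ← Finset.prod_univ_sum]
  exact Finset.prod_eq_one fun i _ => hm i

theorem sum_prod_weight_vertex (hm : ∀ i, ∑ a, m i a = 1) (u : Fin p) (φ : S u → ℝ) :
    ∑ x : ∀ i, S i, (∏ i, m i (x i)) * φ (x u) = ∑ a, m u a * φ a := by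
  classical
  -- The test function is absorbed into the factor at `u`, so that the sum still factorizes.
  let m' : ∀ i, S i → ℝ := fun i a => m i a * if h : i = u then φ (h ▸ a) else 1
  have h1 : ∀ x : ∀ i, S i, (∏ i, m i (x i)) * φ (x u) = ∏ i, m' i (x i) := by
    intro x
    simp only [m', Finset.prod_mul_distrib]
    congr 1
    rw [Finset.prod_eq_single u]
    · simp
    · intro i _ hi
      simp [hi]
    · simp
  simp_rw [h1]
  rw [← Fintype.piFinset_univ, ← Finset.prod_univ_sum, Finset.prod_eq_single u]
  · simp [m']
  · intro i _ hi
    simp [m', hi, hm]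
  · simp

/-- Under a product distribution, the coordinates in `A` and those outside `A` may be sampled
separately. -/
theorem sum_prod_weight_diag (hm : ∀ i, ∑ a, m i a = 1)
    (A : Finset (Fin p)) (K : (∀ i, S i) → (∀ i, S i) → ℝ)
    (hK : ∀ x x' z : ∀ i, S i, (∀ i ∈ A, z i = x i) → (∀ i ∉ A, z i = x' i) → K z z = K x x') :
    ∑ x : ∀ i, S i, (∏ i, m i (x i)) * K x x =
      ∑ x : ∀ i, S i, (∏ i, m i (x i)) * ∑ x' : ∀ i, S i, (∏ i, m i (x' i)) * K x x' := by
  classical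
  -- Two independent samples exchange their coordinates outside `A`; this involution preserves the
  -- product weight.
  let σ : (∀ i, S i) × (∀ i, S i) → (∀ i, S i) × (∀ i, S i) :=
    fun q => (A.piecewise q.1 q.2, A.piecewise q.2 q.1)
  have hσ : Function.Involutive σ := by
    rintro ⟨x, x'⟩
    simp only [σ, Prod.mk.injEq]
    constructor <;> funext i <;> by_cases hi : i ∈ A <;> simp [hi]
  have h1 : ∑ x : ∀ i, S i, (∏ i, m i (x i)) * K x x =
      ∑ q : (∀ i, S i) × (∀ i, S i),
        (∏ i, m i (q.1 i)) * ((∏ i, m i (q.2 i)) * K q.1 q.1) := by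
    rw [Fintype.sum_prod_type]
    refine Finset.sum_congr rfl fun x _ => ?_
    dsimp only
    rw [← Finset.mul_sum, ← Finset.sum_mul, sum_prod_weight_eq_one hm, one_mul]
  rw [h1, ← Equiv.sum_comp hσ.toPerm, Fintype.sum_prod_type]
  refine Finset.sum_congr rfl fun x _ => ?_
  rw [Finset.mul_sum]
  refine Finset.sum_congr rfl fun x' _ => ?_
  change (∏ i, m i (A.piecewise x x' i)) * ((∏ i, m i (A.piecewise x' x i)) *
    K (A.piecewise x x') (A.piecewise x x')) = _
  rw [hK x x' (A.piecewise x x') (fun i hi => by simp [hi]) (fun i hi => by simp [hi]),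
    ← mul_assoc, ← mul_assoc, ← Finset.prod_mul_distrib, ← Finset.prod_mul_distrib]
  congr 1
  refine Finset.prod_congr rfl fun i _ => ?_
  by_cases hi : i ∈ A <;> simp [hi, mul_comm]

/-- The edge weights `g e` are densities, with respect to the product of the weights of the
endpoints, of couplings of these weights. -/
def IsCoupling (m : ∀ i, S i → ℝ) (g : ∀ e : Fin p × Fin p, S e.1 → S e.2 → ℝ)
    (D : Finset (Fin p × Fin p)) : Prop :=
  ∀ e ∈ D, (∀ a, m e.1 a ≠ 0 → ∑ b, m e.2 b * g e a b = 1) ∧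
    ∀ b, m e.2 b ≠ 0 → ∑ a, m e.1 a * g e a b = 1

/-- Removing an edge from a forest splits a forest distribution into two independent ones. -/
theorem exists_split (hm : ∀ i, ∑ a, m i a = 1)
    {D : Finset (Fin p × Fin p)} {e : Fin p × Fin p} (he : e ∉ D) (hD : IsForest (insert e D)) :
    ∃ A : Finset (Fin p), e.1 ∈ A ∧ e.2 ∉ A ∧ ∃ D₁ ⊆ D, ∃ D₂ ⊆ D,
      ∀ K : (∀ i, S i) → (∀ i, S i) → ℝ,
        (∀ x x' z : ∀ i, S i, (∀ i ∈ A, z i = x i) → (∀ i ∉ A, z i = x' i) → K z z = K x x') →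
        ∑ x, forestWeight m g D x * K x x =
          ∑ x, forestWeight m g D₁ x * ∑ x', forestWeight m g D₂ x' * K x x' := by
  classical
  -- The component of `e.1` in `D`: no edge of `D` leaves it, and `e.2` lies outside since `e`
  -- closes no loop.
  let A : Finset (Fin p) := Finset.univ.filter fun v => (graphOf D).Reachable e.1 v
  have hA : ∀ v, v ∈ A ↔ (graphOf D).Reachable e.1 v := fun v => by simp [A]
  have hAD : ∀ f ∈ D, (f.1 ∈ A ↔ f.2 ∈ A) := by
    intro f hf
    have hadj : (graphOf D).Adj f.1 f.2 :=
      graphOf_adj.2 ⟨(hD.1 f (Finset.mem_insert_of_mem hf)).ne, Or.inl hf⟩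
    rw [hA, hA]
    exact ⟨fun h => h.trans hadj.reachable, fun h => h.trans hadj.symm.reachable⟩
  refine ⟨A, (hA _).2 (SimpleGraph.Reachable.refl _),
    fun h => hD.not_reachable_of_insert he ((hA _).1 h),
    D.filter (fun f => f.1 ∈ A), Finset.filter_subset _ _,
    D.filter (fun f => f.1 ∉ A), Finset.filter_subset _ _, fun K hK => ?_⟩
  have h := sum_prod_weight_diag hm A
    (fun x x' => (∏ f ∈ D.filter (fun f => f.1 ∈ A), g f (x f.1) (x f.2)) *
      ((∏ f ∈ D.filter (fun f => f.1 ∉ A), g f (x' f.1) (x' f.2)) * K x x')) ?_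
  · calc ∑ x, forestWeight m g D x * K x x = _ := by
          refine Finset.sum_congr rfl fun x _ => ?_
          rw [forestWeight, ← Finset.prod_filter_mul_prod_filter_not D (fun f => f.1 ∈ A)]
          ring
      _ = _ := h
      _ = _ := by
          refine Finset.sum_congr rfl fun x _ => ?_
          simp only [forestWeight, Finset.mul_sum]
          refine Finset.sum_congr rfl fun x' _ => ?_
          ring
  · intro x x' z hz hz'
    rw [hK x x' z hz hz']
    congr 1
    · refine Finset.prod_congr rfl fun f hf => ?_
      obtain ⟨hfD, hfA⟩ := Finset.mem_filter.1 hf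
      rw [hz _ hfA, hz _ ((hAD f hfD).1 hfA)]
    · congr 1
      refine Finset.prod_congr rfl fun f hf => ?_
      obtain ⟨hfD, hfA⟩ := Finset.mem_filter.1 hf
      rw [hz' _ hfA, hz' _ (fun h => hfA ((hAD f hfD).2 h))]

theorem IsCoupling.subset {D D' : Finset (Fin p × Fin p)} (h : IsCoupling m g D) (hD : D' ⊆ D) :
    IsCoupling m g D' := fun e he => h e (hD he)

/-- The vertex marginals of a forest distribution are the vertex weights. -/
theorem sum_forestWeight_vertex (hm : ∀ i, ∑ a, m i a = 1) (D : Finset (Fin p × Fin p)) :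
    IsForest D → IsCoupling m g D → ∀ (u : Fin p) (φ : S u → ℝ),
      ∑ x, forestWeight m g D x * φ (x u) = ∑ a, m u a * φ a := by
  classical
  induction D using Finset.strongInduction with
  | H D ih =>
    intro hD hg u φ
    rcases D.eq_empty_or_nonempty with rfl | ⟨e, he⟩
    · simpa [forestWeight] using sum_prod_weight_vertex hm u φ
    · obtain ⟨D', he', rfl⟩ : ∃ D', e ∉ D' ∧ insert e D' = D :=
        ⟨D.erase e, Finset.notMem_erase _ _, Finset.insert_erase he⟩
      obtain ⟨A, hA1, hA2, D₁, hD₁, D₂, hD₂, hK⟩ := exists_split (g := g) hm he' hD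
      have hss : ∀ D'' ⊆ D', D'' ⊂ insert e D' := fun D'' h =>
        lt_of_le_of_lt h (Finset.ssubset_insert he')
      have hF : ∀ D'' ⊆ D', ∀ (v : Fin p) (ψ : S v → ℝ),
          ∑ x, forestWeight m g D'' x * ψ (x v) = ∑ a, m v a * ψ a := fun D'' h =>
        ih D'' (hss D'' h) (hD.subset (hss D'' h).subset) (hg.subset (hss D'' h).subset)
      simp_rw [forestWeight_insert he']
      -- The half without `u` is summed out first; by the induction hypothesis and the coupling
      -- condition it contributes the factor one. Where the coupling condition is not available, the
      -- vertex weight vanishes.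
      by_cases hu : u ∈ A
      · have := hK (fun x x' => g e (x e.1) (x' e.2) * φ (x u)) fun x x' z hz hz' => by
          simp only [hz _ hA1, hz' _ hA2, hz _ hu]
        simp_rw [mul_assoc]
        rw [this, ← hF D₁ hD₁ u φ]
        refine Finset.sum_congr rfl fun x _ => ?_
        by_cases h0 : m e.1 (x e.1) = 0
        · simp [forestWeight_eq_zero h0]
        · congr 1
          simp_rw [← mul_assoc]
          rw [← Finset.sum_mul, hF D₂ hD₂ e.2 (fun b => g e (x e.1) b), (hg e he).1 _ h0, one_mul]
      · have := hK (fun x x' => g e (x e.1) (x' e.2) * φ (x' u)) fun x x' z hz hz' => by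
          simp only [hz _ hA1, hz' _ hA2, hz' _ hu]
        simp_rw [mul_assoc]
        rw [this, ← hF D₂ hD₂ u φ]
        simp_rw [Finset.mul_sum]
        rw [Finset.sum_comm]
        refine Finset.sum_congr rfl fun x' _ => ?_
        by_cases h0 : m e.2 (x' e.2) = 0
        · simp [forestWeight_eq_zero h0]
        · have h2 := hF D₁ hD₁ e.1 (fun a => g e a (x' e.2))
          rw [(hg e he).2 _ h0] at h2
          calc _ = (∑ x, forestWeight m g D₁ x * g e (x e.1) (x' e.2)) *
                (forestWeight m g D₂ x' * φ (x' u)) := by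
                rw [Finset.sum_mul]
                exact Finset.sum_congr rfl fun x _ => by ring
            _ = _ := by rw [h2, one_mul]

/-- The edge marginals of a forest distribution. -/
theorem sum_forestWeight_edge (hm : ∀ i, ∑ a, m i a = 1) {D : Finset (Fin p × Fin p)}
    (hD : IsForest D) (hg : IsCoupling m g D) {e : Fin p × Fin p} (he : e ∈ D)
    (φ : S e.1 → S e.2 → ℝ) :
    ∑ x, forestWeight m g D x * φ (x e.1) (x e.2) =
      ∑ a, ∑ b, m e.1 a * m e.2 b * g e a b * φ a b := by
  classical
  obtain ⟨D', he', rfl⟩ : ∃ D', e ∉ D' ∧ insert e D' = D :=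
    ⟨D.erase e, Finset.notMem_erase _ _, Finset.insert_erase he⟩
  obtain ⟨A, hA1, hA2, D₁, hD₁, D₂, hD₂, hK⟩ := exists_split (g := g) hm he' hD
  have hF : ∀ D'' ⊆ D', ∀ (v : Fin p) (ψ : S v → ℝ),
      ∑ x, forestWeight m g D'' x * ψ (x v) = ∑ a, m v a * ψ a := fun D'' h =>
    sum_forestWeight_vertex hm D'' (hD.subset (h.trans (Finset.subset_insert _ _)))
      (hg.subset (h.trans (Finset.subset_insert _ _)))
  simp_rw [forestWeight_insert he', mul_assoc]
  rw [hK (fun x x' => g e (x e.1) (x' e.2) * φ (x e.1) (x' e.2)) fun x x' z hz hz' => by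
    simp only [hz _ hA1, hz' _ hA2]]
  have h2 : ∀ a, ∑ x', forestWeight m g D₂ x' * (g e a (x' e.2) * φ a (x' e.2)) =
      ∑ b, m e.2 b * (g e a b * φ a b) := fun a =>
    hF D₂ hD₂ e.2 (fun b => g e a b * φ a b)
  simp_rw [h2]
  rw [hF D₁ hD₁ e.1 (fun a => ∑ b, m e.2 b * (g e a b * φ a b))]
  simp_rw [Finset.mul_sum]

/-- The entropy of a forest distribution. -/
theorem sum_negMulLog_forestWeight (hm : ∀ i, ∑ a, m i a = 1) {D : Finset (Fin p × Fin p)}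
    (hD : IsForest D) (hg : IsCoupling m g D) :
    ∑ x, Real.negMulLog (forestWeight m g D x) =
      ∑ i, ∑ a, Real.negMulLog (m i a) -
        ∑ e ∈ D, ∑ a, ∑ b, m e.1 a * m e.2 b * g e a b * Real.log (g e a b) := by
  have h1 : ∀ x, Real.negMulLog (forestWeight m g D x) =
      ∑ i, forestWeight m g D x * -Real.log (m i (x i)) -
        ∑ e ∈ D, forestWeight m g D x * Real.log (g e (x e.1) (x e.2)) := by
    intro x
    rw [← Finset.mul_sum, ← Finset.mul_sum, ← mul_sub]
    by_cases h0 : forestWeight m g D x = 0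
    · simp [h0]
    · rw [Real.negMulLog]
      obtain ⟨ha, hb⟩ := mul_ne_zero_iff.1 h0
      nth_rewrite 2 [forestWeight]
      rw [Real.log_mul ha hb, Real.log_prod (fun i _ => Finset.prod_ne_zero_iff.1 ha i
        (Finset.mem_univ i)), Real.log_prod (fun e he => Finset.prod_ne_zero_iff.1 hb e he),
        Finset.sum_neg_distrib]
      ring
  simp_rw [h1]
  rw [Finset.sum_sub_distrib, Finset.sum_comm, Finset.sum_comm (t := D)]
  congr 1
  · refine Finset.sum_congr rfl fun i _ => ?_
    rw [sum_forestWeight_vertex hm D hD hg i (fun a => -Real.log (m i a))]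
    exact Finset.sum_congr rfl fun a _ => by rw [Real.negMulLog]; ring
  · exact Finset.sum_congr rfl fun e he =>
      sum_forestWeight_edge hm hD hg he (fun a b => Real.log (g e a b))

end ForestWeight

/-! ### Uniform asymptotics of the Bayes measure -/

section BayesMeasure

/-- Stirling's approximation of `log Γ (n + s)`, up to a bounded error. -/
def HasStirlingBound (s : ℝ) : Prop :=
  ∃ K : ℝ, ∀ n : ℕ, 1 ≤ n →
    |Real.log (Real.Gamma (n + s)) - (n * Real.log n - n + (s - 1 / 2) * Real.log n)| ≤ K

/-- Here `Γ (n + 1) = n!`, and the logarithm of `stirlingSeq` is antitone and bounded below. Its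
value at one is `1 - log 2 / 2`, which yields the constant `1`. -/
theorem hasStirlingBound_one : HasStirlingBound 1 := by
  refine ⟨1, fun n hn => ?_⟩
  obtain ⟨k, rfl⟩ : ∃ k, n = k + 1 := ⟨n - 1, by omega⟩
  have hpos : (0 : ℝ) < ((k + 1 : ℕ) : ℝ) := by positivity
  have h1 := Stirling.log_stirlingSeq_formula (k + 1)
  have h2 := Stirling.log_stirlingSeq_bounded_by_constant k
  have h3 : Real.log (Stirling.stirlingSeq (k + 1)) ≤ Real.log (Stirling.stirlingSeq 1) :=
    Stirling.log_stirlingSeq'_antitone (Nat.zero_le k)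
  rw [Stirling.stirlingSeq_one, Real.log_div (Real.exp_ne_zero _) (by positivity), Real.log_exp,
    Real.log_sqrt (by norm_num)] at h3
  rw [Real.log_mul (by norm_num) hpos.ne', Real.log_div hpos.ne' (Real.exp_ne_zero _),
    Real.log_exp] at h1
  rw [Real.Gamma_nat_eq_factorial]
  have h4 : (0 : ℝ) ≤ Real.log 2 := Real.log_nonneg (by norm_num)
  rw [abs_le]
  constructor <;> nlinarith

/-- Log-convexity of `Γ` squeezes `Γ (n + 1/2)`: `n + 1/2` is the midpoint of `n` and `n + 1`, and
`n + 1` is the midpoint of `n + 1/2` and `n + 3/2`. -/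
theorem hasStirlingBound_half : HasStirlingBound (1 / 2) := by
  obtain ⟨K, hK⟩ := hasStirlingBound_one
  refine ⟨K + Real.log 2, fun n hn => ?_⟩
  have hpos : (0 : ℝ) < (n : ℝ) := by positivity
  have h1 := abs_le.1 (hK n hn)
  have hconv := Real.convexOn_log_Gamma.2
  have h2 := hconv (x := (n : ℝ)) (y := (n : ℝ) + 1) hpos (by simp; positivity)
    (a := 1 / 2) (b := 1 / 2) (by norm_num) (by norm_num) (by norm_num)
  have h3 := hconv (x := (n : ℝ) + 1 / 2) (y := (n : ℝ) + 1 / 2 + 1) (by simp; positivity)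
    (by simp; positivity) (a := 1 / 2) (b := 1 / 2) (by norm_num) (by norm_num) (by norm_num)
  simp only [Function.comp, smul_eq_mul] at h2 h3
  rw [show (1 / 2 : ℝ) * n + 1 / 2 * (n + 1) = n + 1 / 2 by ring] at h2
  rw [show (1 / 2 : ℝ) * (n + 1 / 2) + 1 / 2 * (n + 1 / 2 + 1) = n + 1 by ring,
    Real.Gamma_add_one (s := (n : ℝ) + 1 / 2) (by positivity),
    Real.log_mul (by positivity) (Real.Gamma_pos_of_pos (by positivity)).ne'] at h3
  have h4 : Real.log (Real.Gamma (n + 1)) = Real.log n + Real.log (Real.Gamma n) := by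
    rw [Real.Gamma_add_one hpos.ne', Real.log_mul hpos.ne' (Real.Gamma_pos_of_pos hpos).ne']
  have h5 : Real.log ((n : ℝ) + 1 / 2) ≤ Real.log 2 + Real.log n := by
    rw [← Real.log_mul (by norm_num) hpos.ne']
    have : (1 : ℝ) ≤ n := by exact_mod_cast hn
    exact Real.log_le_log (by positivity) (by linarith)
  have h6 : (0 : ℝ) ≤ Real.log 2 := Real.log_nonneg (by norm_num)
  rw [abs_le]
  constructor <;> linarith

theorem HasStirlingBound.add_one {s : ℝ} (hs : 0 ≤ s) (h : HasStirlingBound s) :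
    HasStirlingBound (s + 1) := by
  obtain ⟨K, hK⟩ := h
  refine ⟨K + Real.log (1 + s), fun n hn => ?_⟩
  have hpos : (0 : ℝ) < (n : ℝ) := by positivity
  have h1 := abs_le.1 (hK n hn)
  have hn1 : (1 : ℝ) ≤ n := by exact_mod_cast hn
  rw [← add_assoc, Real.Gamma_add_one (by positivity),
    Real.log_mul (by positivity) (Real.Gamma_pos_of_pos (by positivity)).ne']
  have h2 : Real.log n ≤ Real.log (n + s) := Real.log_le_log hpos (by linarith)
  have h3 : Real.log (n + s) ≤ Real.log (1 + s) + Real.log n := by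
    rw [← Real.log_mul (by positivity) hpos.ne']
    exact Real.log_le_log (by positivity) (by nlinarith)
  have h4 : 0 ≤ Real.log (1 + s) := Real.log_nonneg (by linarith)
  rw [abs_le]
  constructor <;> linarith

/-- The total prior mass of the Bayes measure is `|A| / 2`; every such half-integer is reached from
`1/2` or `1` by unit steps. -/
theorem hasStirlingBound_div_two (d : ℕ) : HasStirlingBound (((d + 1 : ℕ) : ℝ) / 2) := by
  induction d using Nat.twoStepInduction with
  | zero => simpa using hasStirlingBound_half
  | one => simpa using hasStirlingBound_one
  | more d h _ =>
    have := h.add_one (by positivity)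
    convert this using 1
    push_cast
    ring

theorem bayesMeasure_pos {A : Type*} [Fintype A] [Nonempty A] (c : A → ℕ) :
    0 < bayesMeasure c := by
  have hA : (0 : ℝ) < Fintype.card A := by exact_mod_cast Fintype.card_pos
  refine mul_pos (div_pos (Real.Gamma_pos_of_pos (by positivity)) (Real.Gamma_pos_of_pos ?_))
    (Finset.prod_pos fun a _ => div_pos (Real.Gamma_pos_of_pos (by positivity))
      (Real.Gamma_pos_of_pos (by norm_num)))
  exact Finset.sum_pos (fun a _ => by positivity) Finset.univ_nonempty

/-- `n log n - ∑ c log c`: the length of the ideal code based on the empirical distribution. -/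
noncomputable def empiricalLength {A : Type*} [Fintype A] (c : A → ℕ) : ℝ :=
  ((∑ a, c a : ℕ) : ℝ) * Real.log ((∑ a, c a : ℕ) : ℝ) - ∑ a, (c a : ℝ) * Real.log (c a)

/-- The Bayes measure differs from the maximal likelihood by a power of the sample size, up to a
constant factor. -/
theorem exists_abs_log_bayesMeasure_le (A : Type*) [Fintype A] [Nonempty A] :
    ∃ K : ℝ, ∀ c : A → ℕ,
      |Real.log (bayesMeasure c) + empiricalLength c +
        ((Fintype.card A : ℝ) - 1) / 2 * Real.log ((∑ a, c a : ℕ) : ℝ)| ≤ K := by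
  obtain ⟨d, hd⟩ : ∃ d, Fintype.card A = d + 1 := ⟨Fintype.card A - 1, by
    have : 0 < Fintype.card A := Fintype.card_pos
    omega⟩
  have hA : (0 : ℝ) < Fintype.card A := by exact_mod_cast Fintype.card_pos
  obtain ⟨K₁, hK₁⟩ := hasStirlingBound_div_two d
  obtain ⟨K₂, hK₂⟩ := hasStirlingBound_half
  rw [← hd] at hK₁
  -- The maximum accommodates zero counts: at `n = 0` the main terms vanish, as `log 0 = 0`.
  have hb₁ : ∀ n : ℕ, |Real.log (Real.Gamma (n + (Fintype.card A : ℝ) / 2)) -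
      (n * Real.log n - n + ((Fintype.card A : ℝ) / 2 - 1 / 2) * Real.log n)| ≤
      max K₁ |Real.log (Real.Gamma ((Fintype.card A : ℝ) / 2))| := by
    intro n
    rcases Nat.eq_zero_or_pos n with rfl | hn
    · simp
    · exact (hK₁ n hn).trans (le_max_left _ _)
  have hb₂ : ∀ n : ℕ, |Real.log (Real.Gamma (n + 1 / 2)) - (n * Real.log n - n)| ≤
      max K₂ |Real.log (Real.Gamma (1 / 2))| := by
    intro n
    rcases Nat.eq_zero_or_pos n with rfl | hn
    · simp
    · refine le_trans (le_of_eq ?_) ((hK₂ n hn).trans (le_max_left _ _))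
      congr 1
      ring
  set B₁ := max K₁ |Real.log (Real.Gamma ((Fintype.card A : ℝ) / 2))|
  set B₂ := max K₂ |Real.log (Real.Gamma (1 / 2))|
  refine ⟨|Real.log (Real.Gamma ((Fintype.card A : ℝ) / 2))| + B₁ +
    Fintype.card A * (B₂ + |Real.log (Real.Gamma (1 / 2))|), fun c => ?_⟩
  set n : ℕ := ∑ a, c a with hn
  have hsum : ∑ a, ((c a : ℝ) + 1 / 2) = n + (Fintype.card A : ℝ) / 2 := by
    rw [Finset.sum_add_distrib, hn]
    push_cast
    simp
    ring
  have hlog : Real.log (bayesMeasure c) = Real.log (Real.Gamma ((Fintype.card A : ℝ) / 2)) -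
      Real.log (Real.Gamma (n + (Fintype.card A : ℝ) / 2)) +
      ∑ a, (Real.log (Real.Gamma ((c a : ℝ) + 1 / 2)) - Real.log (Real.Gamma (1 / 2))) := by
    have hG : ∀ s : ℝ, 0 < s → Real.Gamma s ≠ 0 := fun s hs => (Real.Gamma_pos_of_pos hs).ne'
    have hc : ∀ a, Real.Gamma ((c a : ℝ) + 1 / 2) ≠ 0 := fun a => hG _ (by positivity)
    have hh : Real.Gamma (1 / 2) ≠ 0 := hG _ (by norm_num)
    rw [bayesMeasure, hsum, Real.log_mul (div_ne_zero (hG _ (by positivity)) (hG _ (by positivity)))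
      (Finset.prod_ne_zero_iff.2 fun a _ => div_ne_zero (hc a) hh),
      Real.log_div (hG _ (by positivity)) (hG _ (by positivity)),
      Real.log_prod (fun a _ => div_ne_zero (hc a) hh)]
    congr 1
    exact Finset.sum_congr rfl fun a _ => Real.log_div (hc a) hh
  have hcs : ∑ a, (c a : ℝ) = n := by rw [hn]; push_cast; rfl
  -- The linear Stirling terms cancel because the counts sum to `n`; only bounded errors remain.
  have hdec : Real.log (bayesMeasure c) + empiricalLength c +
      ((Fintype.card A : ℝ) - 1) / 2 * Real.log n =
      Real.log (Real.Gamma ((Fintype.card A : ℝ) / 2)) -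
      (Real.log (Real.Gamma (n + (Fintype.card A : ℝ) / 2)) -
        (n * Real.log n - n + ((Fintype.card A : ℝ) / 2 - 1 / 2) * Real.log n)) +
      ∑ a, ((Real.log (Real.Gamma ((c a : ℝ) + 1 / 2)) - (c a * Real.log (c a) - c a)) -
        Real.log (Real.Gamma (1 / 2))) := by
    rw [hlog, empiricalLength, ← hn]
    simp only [Finset.sum_sub_distrib, hcs]
    ring
  rw [hdec]
  refine (abs_add_le _ _).trans (add_le_add ((abs_sub _ _).trans (add_le_add le_rfl (hb₁ n))) ?_)
  refine (Finset.abs_sum_le_sum_abs _ _).trans ?_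
  rw [← nsmul_eq_mul, ← Finset.card_univ]
  exact Finset.sum_le_card_nsmul _ _ _ fun a _ =>
    (abs_sub _ _).trans (add_le_add (hb₂ (c a)) le_rfl)

end BayesMeasure

/-! ### Expected empirical code lengths of independent samples -/

section Counts

variable {n : ℕ} {S A : Type*}

open Classical in
/-- The number of the samples in which the feature `v` is observed with value `a`. -/
noncomputable def counts (v : S → Option A) (x : Fin n → S) (a : A) : ℕ :=
  (Finset.univ.filter fun k => v (x k) = some a).card

open Classical in
theorem sum_counts [Fintype A] (v : S → Option A) (x : Fin n → S) :
    ∑ a, counts v x a = (Finset.univ.filter fun k => v (x k) ≠ none).card := by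
  simp only [counts]
  rw [← Finset.card_biUnion]
  · congr 1
    ext k
    simp [Option.ne_none_iff_exists']
  · intro a _ b _ hab
    rw [Function.onFun, Finset.disjoint_left]
    intro k hk hk'
    simp only [Finset.mem_filter, Finset.mem_univ, true_and] at hk hk'
    exact hab (Option.some.inj (hk.symm.trans hk'))

open Classical in
theorem cast_counts (v : S → Option A) (x : Fin n → S) (a : A) :
    (counts v x a : ℝ) = ∑ k, if v (x k) = some a then (1 : ℝ) else 0 := by
  simp [counts]

/-- Gibbs' inequality for counts. -/
theorem empiricalLength_le [Fintype A] {c : A → ℕ} {P : A → ℝ} (hP0 : ∀ a, 0 ≤ P a)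
    (hP1 : (∑ a, c a : ℕ) ≠ 0 → ∑ a, P a = 1) (hc : ∀ a, c a ≠ 0 → P a ≠ 0) :
    empiricalLength c ≤ -∑ a, (c a : ℝ) * Real.log (P a) := by
  rw [empiricalLength]
  set N : ℕ := ∑ a, c a with hN
  have hcs : ∑ a, (c a : ℝ) = N := by rw [hN]; push_cast; rfl
  -- This is `log t ≤ t - 1` at `t = N * P a / c a`; the right-hand sides sum to zero.
  have key : ∀ a, (c a : ℝ) * Real.log N - c a * Real.log (c a) + c a * Real.log (P a) ≤
      N * P a - c a := by
    intro a
    rcases Nat.eq_zero_or_pos (c a) with h0 | h0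
    · rw [h0]
      have := hP0 a
      simp only [CharP.cast_eq_zero, zero_mul, sub_self, add_zero, sub_zero]
      positivity
    · have hca : (0 : ℝ) < c a := by exact_mod_cast h0
      have hPa : 0 < P a := (hP0 a).lt_of_ne' (hc a h0.ne')
      have hle : c a ≤ N := Finset.single_le_sum (fun b _ => Nat.zero_le _) (Finset.mem_univ a)
      have hNpos : (0 : ℝ) < N := by exact_mod_cast lt_of_lt_of_le h0 hle
      have h1 := Real.log_le_sub_one_of_pos (x := N * P a / c a) (by positivity)
      rw [Real.log_div (by positivity) (by positivity), Real.log_mul (by positivity)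
        (by positivity)] at h1
      have h2 := mul_le_mul_of_nonneg_left h1 hca.le
      have h3 : (c a : ℝ) * (N * P a / c a - 1) = N * P a - c a := by field_simp
      linarith
  have hsum := Finset.sum_le_sum fun a (_ : a ∈ Finset.univ) => key a
  rw [Finset.sum_add_distrib, Finset.sum_sub_distrib, Finset.sum_sub_distrib, ← Finset.sum_mul,
    ← Finset.mul_sum, hcs] at hsum
  have h0 : (N : ℝ) * ∑ a, P a = N := by
    by_cases hN0 : N = 0
    · simp [hN0]
    · rw [hP1 hN0, mul_one]
  linarith

/-- A bound of the empirical divergence by the chi-squared distance. -/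
theorem neg_empiricalLength_le [Fintype A] {c : A → ℕ} {P : A → ℝ} (hP0 : ∀ a, 0 ≤ P a)
    (hP1 : (∑ a, c a : ℕ) ≠ 0 → ∑ a, P a = 1) (hc : ∀ a, c a ≠ 0 → P a ≠ 0) :
    -empiricalLength c ≤ ∑ a, (c a : ℝ) * Real.log (P a) +
      ∑ a, ((c a : ℝ) - (∑ a, c a : ℕ) * P a) ^ 2 / ((∑ a, c a : ℕ) * P a) := by
  rw [empiricalLength]
  set N : ℕ := ∑ a, c a with hN
  have hcs : ∑ a, (c a : ℝ) = N := by rw [hN]; push_cast; rfl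
  -- Now `log t ≤ t - 1` at the inverse ratio `t = c a / (N * P a)`, with the square completed; the
  -- linear remainders sum to zero.
  have key : ∀ a, (c a : ℝ) * Real.log (c a) - c a * Real.log N - c a * Real.log (P a) ≤
      ((c a : ℝ) - N * P a) ^ 2 / (N * P a) + (c a - N * P a) := by
    intro a
    rcases Nat.eq_zero_or_pos (c a) with h0 | h0
    · rw [h0]
      simp only [CharP.cast_eq_zero, zero_mul, sub_self, zero_sub]
      by_cases h : (N : ℝ) * P a = 0
      · simp [h]
      · apply le_of_eq
        field_simp
        ring
    · have hca : (0 : ℝ) < c a := by exact_mod_cast h0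
      have hPa : 0 < P a := (hP0 a).lt_of_ne' (hc a h0.ne')
      have hle : c a ≤ N := Finset.single_le_sum (fun b _ => Nat.zero_le _) (Finset.mem_univ a)
      have hNpos : (0 : ℝ) < N := by exact_mod_cast lt_of_lt_of_le h0 hle
      have h1 := Real.log_le_sub_one_of_pos (x := c a / (N * P a)) (by positivity)
      rw [Real.log_div (by positivity) (by positivity), Real.log_mul (by positivity)
        (by positivity)] at h1
      have h2 := mul_le_mul_of_nonneg_left h1 hca.le
      have h3 : (c a : ℝ) * (c a / (N * P a) - 1) =
          ((c a : ℝ) - N * P a) ^ 2 / (N * P a) + (c a - N * P a) := by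
        field_simp
        ring
      linarith
  have hsum := Finset.sum_le_sum fun a (_ : a ∈ Finset.univ) => key a
  rw [Finset.sum_add_distrib, Finset.sum_sub_distrib, Finset.sum_sub_distrib,
    Finset.sum_sub_distrib, ← Finset.sum_mul, ← Finset.mul_sum, hcs] at hsum
  have h0 : (N : ℝ) * ∑ a, P a = N := by
    by_cases hN0 : N = 0
    · simp [hN0]
    · rw [hP1 hN0, mul_one]
  linarith

variable [Fintype S] {q : Fin n → S → ℝ}

theorem sum_prod_mul_sum (hq : ∀ k, ∑ s, q k s = 1) (h : Fin n → S → ℝ) :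
    ∑ x : Fin n → S, (∏ k, q k (x k)) * ∑ k, h k (x k) = ∑ k, ∑ s, q k s * h k s := by
  simp_rw [Finset.mul_sum]
  rw [Finset.sum_comm]
  exact Finset.sum_congr rfl fun k _ =>
    sum_prod_weight_vertex (S := fun _ : Fin n => S) (m := q) hq k (h k)

/-- The variance of a sum of independent centred variables. -/
theorem sum_prod_mul_sum_sq (hq : ∀ k, ∑ s, q k s = 1) (h : Fin n → S → ℝ)
    (h0 : ∀ k, ∑ s, q k s * h k s = 0) :
    ∑ x : Fin n → S, (∏ k, q k (x k)) * (∑ k, h k (x k)) ^ 2 =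
      ∑ k, ∑ s, q k s * h k s ^ 2 := by
  -- Resampling all coordinates except `k` makes the factor at `l` independent of the one at `k`,
  -- and it has mean zero.
  have hcross : ∀ k l, k ≠ l →
      ∑ x : Fin n → S, (∏ k, q k (x k)) * (h k (x k) * h l (x l)) = 0 := by
    intro k l hkl
    rw [sum_prod_weight_diag (S := fun _ : Fin n => S) (m := q) hq {k}
      (fun x x' => h k (x k) * h l (x' l)) fun x x' z hz hz' => by
        rw [hz k (Finset.mem_singleton_self k), hz' l (by simpa using hkl.symm)]]
    refine Finset.sum_eq_zero fun x _ => ?_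
    have h1 := sum_prod_weight_vertex (S := fun _ : Fin n => S) (m := q) hq l
      (fun s => h k (x k) * h l s)
    rw [h1]
    have h2 : ∑ s, q l s * (h k (x k) * h l s) = h k (x k) * ∑ s, q l s * h l s := by
      rw [Finset.mul_sum]
      exact Finset.sum_congr rfl fun s _ => by ring
    rw [h2, h0, mul_zero, mul_zero]
  simp_rw [sq (∑ k, h k _), Finset.sum_mul_sum, Finset.mul_sum]
  rw [Finset.sum_comm]
  refine Finset.sum_congr rfl fun k _ => ?_
  rw [Finset.sum_comm, Finset.sum_eq_single k]
  · rw [← sum_prod_weight_vertex (S := fun _ : Fin n => S) (m := q) hq k (fun s => h k s ^ 2)]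
    exact Finset.sum_congr rfl fun x _ => by rw [sq]
  · intro l _ hl
    exact hcross k l hl.symm
  · simp

/-- Under the independent laws `q k`, the feature `v` is observed exactly for `k ∈ T`, and then
has law `P`. -/
structure IsObserved [Fintype A] (q : Fin n → S → ℝ) (v : S → Option A) (T : Finset (Fin n))
    (P : A → ℝ) : Prop where
  nonneg : ∀ k s, 0 ≤ q k s
  sum_eq_one : ∀ k, ∑ s, q k s = 1
  law_nonneg : ∀ a, 0 ≤ P a
  -- A conditional law given a null event is identically zero, so normalization can be required only
  -- if something is observed.
  law_sum : T.Nonempty → ∑ a, P a = 1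
  law_eq : ∀ k a, (∑ s, open Classical in if v s = some a then q k s else 0) =
    open Classical in if k ∈ T then P a else 0

namespace IsObserved

variable [Fintype A] {v : S → Option A} {T : Finset (Fin n)} {P : A → ℝ}

theorem eq_zero_of_law (h : IsObserved q v T P) {k : Fin n} {s : S} {a : A} (hs : v s = some a)
    (hk : k ∈ T → P a = 0) : q k s = 0 := by
  classical
  have h1 := h.law_eq k a
  have h2 : (if k ∈ T then P a else 0) = 0 := by
    split_ifs with hkT
    exacts [hk hkT, rfl]
  rw [h2, Finset.sum_eq_zero_iff_of_nonneg fun s _ => by split_ifs; exacts [h.nonneg k s, le_rfl]]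
    at h1
  simpa [hs] using h1 s (Finset.mem_univ s)

/-- For `k ∈ T` the observed values already carry total mass one. -/
theorem eq_zero_of_none (h : IsObserved q v T P) {k : Fin n} {s : S} (hs : v s = none)
    (hk : k ∈ T) : q k s = 0 := by
  classical
  have h1 : ∑ a, ∑ s, (if v s = some a then q k s else 0) = 1 := by
    rw [← h.law_sum ⟨k, hk⟩]
    refine Finset.sum_congr rfl fun a _ => ?_
    have := h.law_eq k a
    rw [if_pos hk] at this
    rw [← this]
  rw [Finset.sum_comm] at h1
  have h2 : ∀ s, ∑ a, (if v s = some a then q k s else 0) = if v s = none then 0 else q k s := by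
    intro s
    rcases hvs : v s with _ | b
    · simp
    · simp [Option.some.injEq]
  simp_rw [h2] at h1
  have h3 : ∑ s, (q k s - if v s = none then 0 else q k s) = 0 := by
    rw [Finset.sum_sub_distrib, h1, h.sum_eq_one, sub_self]
  rw [Finset.sum_eq_zero_iff_of_nonneg fun s _ => by
    have := h.nonneg k s
    split_ifs <;> simp [this]] at h3
  simpa [hs] using h3 s (Finset.mem_univ s)

/-- On samples of positive probability the sample size is deterministic, so the counts can be
compared with fixed means. -/
theorem sum_counts_eq (h : IsObserved q v T P) {x : Fin n → S} (hx : ∏ k, q k (x k) ≠ 0) :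
    ∑ a, counts v x a = T.card := by
  classical
  rw [sum_counts]
  congr 1
  ext k
  simp only [Finset.mem_filter, Finset.mem_univ, true_and]
  have hk : q k (x k) ≠ 0 := Finset.prod_ne_zero_iff.1 hx k (Finset.mem_univ k)
  constructor
  · intro hv
    obtain ⟨a, ha⟩ := Option.ne_none_iff_exists'.1 hv
    by_contra hkT
    exact hk (h.eq_zero_of_law ha fun h' => absurd h' hkT)
  · intro hkT hv
    exact hk (h.eq_zero_of_none hv hkT)

theorem law_ne_zero (h : IsObserved q v T P) {x : Fin n → S} (hx : ∏ k, q k (x k) ≠ 0) {a : A}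
    (ha : counts v x a ≠ 0) : P a ≠ 0 := by
  classical
  intro hP
  rw [counts, Finset.card_ne_zero] at ha
  obtain ⟨k, hk⟩ := ha
  exact Finset.prod_ne_zero_iff.1 hx k (Finset.mem_univ k)
    (h.eq_zero_of_law (Finset.mem_filter.1 hk).2 fun _ => hP)

theorem sum_prod_mul_counts (h : IsObserved q v T P) (a : A) :
    ∑ x : Fin n → S, (∏ k, q k (x k)) * (counts v x a : ℝ) = T.card * P a := by
  classical
  simp_rw [cast_counts]
  rw [sum_prod_mul_sum h.sum_eq_one (fun _ s => if v s = some a then (1 : ℝ) else 0)]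
  have : ∀ k, ∑ s, q k s * (if v s = some a then (1 : ℝ) else 0) = if k ∈ T then P a else 0 := by
    intro k
    rw [← h.law_eq k a]
    exact Finset.sum_congr rfl fun s _ => by split_ifs <;> simp
  simp_rw [this]
  simp

/-- By independence this is a sum over `T` of Bernoulli variances `P a * (1 - P a)`. The bound is
exactly the denominator of the chi-squared term. -/
theorem sum_prod_mul_counts_sub_sq_le (h : IsObserved q v T P) (a : A) :
    ∑ x : Fin n → S, (∏ k, q k (x k)) * ((counts v x a : ℝ) - T.card * P a) ^ 2 ≤
      T.card * P a := by
  classical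
  let f : Fin n → S → ℝ := fun k s =>
    (if v s = some a then (1 : ℝ) else 0) - if k ∈ T then P a else 0
  have hf : ∀ x : Fin n → S, (counts v x a : ℝ) - T.card * P a = ∑ k, f k (x k) := by
    intro x
    simp only [f, Finset.sum_sub_distrib, cast_counts]
    simp
  have h1 : ∀ k, ∑ s, q k s * (if v s = some a then (1 : ℝ) else 0) =
      if k ∈ T then P a else 0 := by
    intro k
    rw [← h.law_eq k a]
    exact Finset.sum_congr rfl fun s _ => by split_ifs <;> simp
  simp_rw [hf]
  rw [sum_prod_mul_sum_sq h.sum_eq_one f]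
  · have h2 : ∀ k, ∑ s, q k s * f k s ^ 2 ≤ if k ∈ T then P a else 0 := by
      intro k
      have h3 : ∑ s, q k s * f k s ^ 2 =
          (1 - 2 * (if k ∈ T then P a else 0)) *
            ∑ s, q k s * (if v s = some a then (1 : ℝ) else 0) +
          (if k ∈ T then P a else 0) ^ 2 * ∑ s, q k s := by
        rw [Finset.mul_sum, Finset.mul_sum, ← Finset.sum_add_distrib]
        refine Finset.sum_congr rfl fun s _ => ?_
        simp only [f]
        split_ifs <;> ring
      rw [h3, h1, h.sum_eq_one]
      nlinarith [sq_nonneg (if k ∈ T then P a else 0)]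
    refine (Finset.sum_le_sum fun k _ => h2 k).trans (le_of_eq ?_)
    simp
  · intro k
    simp only [f, mul_sub, Finset.sum_sub_distrib]
    rw [h1, ← Finset.sum_mul, h.sum_eq_one, one_mul, sub_self]

theorem prod_nonneg (h : IsObserved q v T P) (x : Fin n → S) : 0 ≤ ∏ k, q k (x k) :=
  Finset.prod_nonneg fun k _ => h.nonneg k _

theorem sum_prod_mul_sum_counts_log (h : IsObserved q v T P) :
    ∑ x : Fin n → S, (∏ k, q k (x k)) * ∑ a, (counts v x a : ℝ) * Real.log (P a) =
      -(T.card * ∑ a, Real.negMulLog (P a)) := by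
  simp_rw [Finset.mul_sum]
  rw [Finset.sum_comm, ← Finset.sum_neg_distrib]
  refine Finset.sum_congr rfl fun a _ => ?_
  simp_rw [← mul_assoc]
  rw [← Finset.sum_mul, h.sum_prod_mul_counts, Real.negMulLog]
  ring

/-- The expected empirical code length is at most the entropy. -/
theorem sum_prod_mul_empiricalLength_le (h : IsObserved q v T P) :
    ∑ x : Fin n → S, (∏ k, q k (x k)) * empiricalLength (counts v x) ≤
      T.card * ∑ a, Real.negMulLog (P a) := by
  have h1 : ∀ x : Fin n → S, (∏ k, q k (x k)) * empiricalLength (counts v x) ≤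
      -((∏ k, q k (x k)) * ∑ a, (counts v x a : ℝ) * Real.log (P a)) := by
    intro x
    by_cases hx : ∏ k, q k (x k) = 0
    · simp [hx]
    · rw [← mul_neg]
      refine mul_le_mul_of_nonneg_left (empiricalLength_le h.law_nonneg (fun hN => ?_)
        fun a => h.law_ne_zero hx) (h.prod_nonneg x)
      rw [h.sum_counts_eq hx] at hN
      exact h.law_sum (Finset.card_ne_zero.1 hN)
  refine (Finset.sum_le_sum fun x _ => h1 x).trans (le_of_eq ?_)
  rw [Finset.sum_neg_distrib, h.sum_prod_mul_sum_counts_log, neg_neg]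

/-- The expected empirical code length falls short of the entropy by a bounded amount. -/
theorem sum_prod_mul_neg_empiricalLength_le (h : IsObserved q v T P) :
    ∑ x : Fin n → S, (∏ k, q k (x k)) * -empiricalLength (counts v x) ≤
      -(T.card * ∑ a, Real.negMulLog (P a)) + Fintype.card A := by
  have h1 : ∀ x : Fin n → S, (∏ k, q k (x k)) * -empiricalLength (counts v x) ≤
      (∏ k, q k (x k)) * ∑ a, (counts v x a : ℝ) * Real.log (P a) +
        ∑ a, (∏ k, q k (x k)) * ((counts v x a : ℝ) - T.card * P a) ^ 2 / (T.card * P a) := by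
    intro x
    by_cases hx : ∏ k, q k (x k) = 0
    · simp [hx]
    · simp_rw [mul_div_assoc]
      rw [← Finset.mul_sum, ← mul_add]
      have h2 := neg_empiricalLength_le (c := counts v x) h.law_nonneg (fun hN => ?_)
        fun a => h.law_ne_zero hx
      · rw [h.sum_counts_eq hx] at h2
        exact mul_le_mul_of_nonneg_left h2 (h.prod_nonneg x)
      · rw [h.sum_counts_eq hx] at hN
        exact h.law_sum (Finset.card_ne_zero.1 hN)
  refine (Finset.sum_le_sum fun x _ => h1 x).trans ?_
  rw [Finset.sum_add_distrib, h.sum_prod_mul_sum_counts_log, Finset.sum_comm]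
  refine add_le_add le_rfl ?_
  -- Each value contributes at most one, whatever the sample size and however small `P a`; for a
  -- zero denominator the quotient is `0`.
  calc _ ≤ ∑ a : A, (1 : ℝ) := by
        refine Finset.sum_le_sum fun a _ => ?_
        rw [← Finset.sum_div]
        exact div_le_one_of_le₀ (h.sum_prod_mul_counts_sub_sq_le a)
          (mul_nonneg (by positivity) (h.law_nonneg a))
    _ = _ := by simp

end IsObserved

end Counts

/-! ### Expectations over the source -/

section Finite

variable {Ω F : Type*} [MeasurableSpace Ω] [MeasurableSpace F] [Fintype F]
  [MeasurableSingletonClass F] {ρ : Measure Ω} [IsFiniteMeasure ρ] {Z : Ω → F}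

theorem integrable_comp_finite (hZ : Measurable Z) (f : F → ℝ) :
    Integrable (fun ω => f (Z ω)) ρ :=
  (Integrable.of_finite (f := f) (μ := ρ.map Z)).comp_measurable hZ

theorem integral_comp_finite (hZ : Measurable Z) (f : F → ℝ) :
    ∫ ω, f (Z ω) ∂ρ = ∑ z, ρ.real {ω | Z ω = z} * f z := by
  rw [← integral_map hZ.aemeasurable (f := f) (measurable_of_finite f).aestronglyMeasurable,
    integral_fintype Integrable.of_finite]
  refine Finset.sum_congr rfl fun z _ => ?_
  rw [map_measureReal_apply hZ (measurableSet_singleton z), smul_eq_mul]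
  rfl

open Classical in
theorem measureReal_eq_sum (hZ : Measurable Z) (B : F → Prop) :
    ρ.real {ω | B (Z ω)} = ∑ z, if B z then ρ.real {ω | Z ω = z} else 0 := by
  have h := integral_comp_finite (ρ := ρ) hZ (Set.indicator {z | B z} 1)
  have h2 : ∀ ω, Set.indicator {z | B z} (1 : F → ℝ) (Z ω) =
      Set.indicator {ω | B (Z ω)} (1 : Ω → ℝ) ω := fun ω => rfl
  simp_rw [h2] at h
  have hB : MeasurableSet {ω | B (Z ω)} := hZ (Set.toFinite {z | B z}).measurableSet
  rw [integral_indicator_one hB] at h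
  rw [h]
  refine Finset.sum_congr rfl fun z _ => ?_
  by_cases hz : B z <;> simp [Set.indicator, hz]

end Finite

/-! ### Averaging over the missingness patterns -/

section Source

variable {p : ℕ} {α : Fin p → ℕ} {Ω : Type*} [MeasurableSpace Ω] {μ : Measure Ω}
  {X : ℕ → Ω → Row α} {Y : ℕ → Ω → Fin p → Bool}

/-- The law of a sample given its missingness pattern `y`. -/
noncomputable def patternLaw (μ : Measure Ω) (X : ℕ → Ω → Row α) (Y : ℕ → Ω → Fin p → Bool)
    (y : Fin p → Bool) (s : Row α) : ℝ :=
  (μ[|{ω | Y 0 ω = y}]).real {ω | X 0 ω = s}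

namespace IsIncompleteSource

theorem measurable_frame (h : IsIncompleteSource μ X Y) (n : ℕ) : Measurable (frame X n) :=
  measurable_pi_lambda _ fun k => h.measurable_X k

/-- The marginals of a stationary source of patterns agree. -/
theorem measureReal_pattern (h : IsIncompleteSource μ X Y) (k : ℕ) (t : (Fin p → Bool) → Prop) :
    μ.real {ω | t (Y k ω)} = μ.real {ω | t (Y 0 ω)} := by
  have hY : Measurable fun ω k => Y k ω := measurable_pi_lambda _ fun k => h.measurable_Y k
  have hset : ∀ k, MeasurableSet {z : ℕ → Fin p → Bool | t (z k)} := fun k =>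
    measurable_pi_apply k (Set.toFinite {y | t y}).measurableSet
  induction k with
  | zero => rfl
  | succ k ih =>
    have h1 := h.ergodic.toMeasurePreserving.measure_preimage (hset k).nullMeasurableSet
    rw [Set.preimage_ofPred_eq, Measure.map_apply hY (hset (k + 1)),
      Measure.map_apply hY (hset k)] at h1
    rw [← ih]
    exact congrArg ENNReal.toReal h1

theorem pattern_ne_zero [IsFiniteMeasure μ] (h : IsIncompleteSource μ X Y) {n : ℕ}
    {y : Fin n → Fin p → Bool}
    (hy : μ.real {ω | ∀ k : Fin n, Y k ω = y k} ≠ 0) (k : Fin n) :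
    μ.real {ω | Y 0 ω = y k} ≠ 0 := by
  intro h0
  refine hy (le_antisymm ?_ measureReal_nonneg)
  rw [← h0, ← h.measureReal_pattern k (fun z => z = y k)]
  exact measureReal_mono fun ω hω => hω k

/-- Conditioning on the patterns reduces expectations to finite sums over product laws, where the
bounds for independent samples apply. -/
theorem integral_frame [IsFiniteMeasure μ] (h : IsIncompleteSource μ X Y) (n : ℕ)
    (f : (Fin n → Row α) → ℝ) :
    ∫ ω, f (frame X n ω) ∂μ = ∑ y : Fin n → Fin p → Bool,
      μ.real {ω | ∀ k : Fin n, Y k ω = y k} *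
        ∑ x : Fin n → Row α, (∏ k, patternLaw μ X Y (y k) (x k)) * f x := by
  have hY : Measurable fun ω (k : Fin n) => Y k ω :=
    measurable_pi_lambda _ fun k => h.measurable_Y k
  have h1 := integral_comp_finite (ρ := μ) ((h.measurable_frame n).prodMk hY) (fun z => f z.1)
  rw [h1, Fintype.sum_prod_type, Finset.sum_comm]
  refine Finset.sum_congr rfl fun y _ => ?_
  rw [Finset.mul_sum]
  refine Finset.sum_congr rfl fun x _ => ?_
  have h2 := h.memoryless n x y
  have h3 : {ω | (frame X n ω, fun k : Fin n => Y k ω) = (x, y)} =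
      {ω | ∀ k : Fin n, X k ω = x k ∧ Y k ω = y k} := by
    ext ω
    simp [frame, funext_iff, forall_and]
  rw [h3, h2, mul_assoc]
  rfl

/-- Linearity of expectation and stationarity; this turns sample sizes into `n * r` and `n * r₂`. -/
theorem sum_pattern_mul_card [IsProbabilityMeasure μ] (h : IsIncompleteSource μ X Y) (n : ℕ)
    (t : (Fin p → Bool) → Prop) [DecidablePred t] :
    ∑ y : Fin n → Fin p → Bool, μ.real {ω | ∀ k : Fin n, Y k ω = y k} *
      ((Finset.univ.filter fun k => t (y k)).card : ℝ) = n * μ.real {ω | t (Y 0 ω)} := by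
  have hY : Measurable fun ω (k : Fin n) => Y k ω :=
    measurable_pi_lambda _ fun k => h.measurable_Y k
  have h1 := integral_comp_finite (ρ := μ) hY
    (fun y => ((Finset.univ.filter fun k => t (y k)).card : ℝ))
  simp only [funext_iff (f := fun k : Fin n => Y k _)] at h1
  rw [← h1]
  have h2 : ∀ ω, ((Finset.univ.filter fun k : Fin n => t (Y k ω)).card : ℝ) =
      ∑ k : Fin n, Set.indicator {ω | t (Y k ω)} (1 : Ω → ℝ) ω := by
    intro ω
    simp [Set.indicator_apply]
  have hm : ∀ k, MeasurableSet {ω | t (Y k ω)} := fun k =>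
    h.measurable_Y k (Set.toFinite {y | t y}).measurableSet
  simp_rw [h2]
  rw [integral_finsetSum (f := fun (k : Fin n) ω => Set.indicator {ω | t (Y k ω)} (1 : Ω → ℝ) ω) _
    fun k _ => (integrable_const (1 : ℝ)).indicator (hm k)]
  simp_rw [integral_indicator_one (hm _), h.measureReal_pattern _ t]
  simp

end IsIncompleteSource

/-- The feature `v` of a sample is observed exactly if its missingness pattern satisfies `t`, and
then has law `P`, whatever the pattern is. -/
structure IsFeature (μ : Measure Ω) (X : ℕ → Ω → Row α) (Y : ℕ → Ω → Fin p → Bool) {A : Type*}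
    [Fintype A] (v : Row α → Option A) (t : (Fin p → Bool) → Prop) (P : A → ℝ) : Prop where
  nonneg : ∀ a, 0 ≤ P a
  sum_eq_one : ∀ y, μ.real {ω | Y 0 ω = y} ≠ 0 → t y → ∑ a, P a = 1
  law_pos : ∀ y, μ.real {ω | Y 0 ω = y} ≠ 0 → t y → ∀ a,
    (μ[|{ω | Y 0 ω = y}]).real {ω | v (X 0 ω) = some a} = P a
  law_neg : ∀ y, μ.real {ω | Y 0 ω = y} ≠ 0 → ¬ t y → ∀ a,
    (μ[|{ω | Y 0 ω = y}]).real {ω | v (X 0 ω) = some a} = 0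

namespace IsFeature

variable {A B : Type*} [Fintype A] [Fintype B] {v : Row α → Option A} {t : (Fin p → Bool) → Prop}
  {P : A → ℝ}

theorem sum_patternLaw [IsProbabilityMeasure μ] (hXY : IsIncompleteSource μ X Y) {y : Fin p → Bool}
    (hy : μ.real {ω | Y 0 ω = y} ≠ 0) : ∑ s, patternLaw μ X Y y s = 1 := by
  classical
  have : IsProbabilityMeasure (μ[|{ω | Y 0 ω = y}]) :=
    cond_isProbabilityMeasure fun h => hy (by simp [Measure.real, h])
  have h := measureReal_eq_sum (ρ := μ[|{ω | Y 0 ω = y}]) (hXY.measurable_X 0) (fun _ => True)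
  simp only [Set.ofPred_true, probReal_univ, if_true] at h
  exact h.symm

open Classical in
theorem isObserved [IsProbabilityMeasure μ] (hXY : IsIncompleteSource μ X Y)
    (h : IsFeature μ X Y v t P) {n : ℕ} {y : Fin n → Fin p → Bool}
    (hy : μ.real {ω | ∀ k : Fin n, Y k ω = y k} ≠ 0) :
    IsObserved (fun k => patternLaw μ X Y (y k)) v (Finset.univ.filter fun k => t (y k)) P where
  nonneg k s := measureReal_nonneg
  sum_eq_one k := sum_patternLaw hXY (hXY.pattern_ne_zero hy k)
  law_nonneg := h.nonneg
  law_sum := by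
    rintro ⟨k, hk⟩
    exact h.sum_eq_one (y k) (hXY.pattern_ne_zero hy k) (Finset.mem_filter.1 hk).2
  law_eq k a := by
    have hk := hXY.pattern_ne_zero hy k
    have h1 := measureReal_eq_sum (ρ := μ[|{ω | Y 0 ω = y k}]) (hXY.measurable_X 0)
      (fun s => v s = some a)
    refine (Finset.sum_congr rfl fun s _ => ?_).trans (h1.symm.trans ?_)
    · split_ifs <;> rfl
    by_cases ht : t (y k)
    · simp [ht, h.law_pos _ hk ht]
    · simp [ht, h.law_neg _ hk ht]

theorem integral_empiricalLength_le [IsProbabilityMeasure μ] (hXY : IsIncompleteSource μ X Y)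
    (h : IsFeature μ X Y v t P) (n : ℕ) :
    ∫ ω, empiricalLength (counts v (frame X n ω)) ∂μ ≤
      n * (μ.real {ω | t (Y 0 ω)} * ∑ a, Real.negMulLog (P a)) := by
  classical
  rw [hXY.integral_frame n fun x => empiricalLength (counts v x), ← mul_assoc,
    ← hXY.sum_pattern_mul_card n t, Finset.sum_mul]
  refine Finset.sum_le_sum fun y _ => ?_
  by_cases hy : μ.real {ω | ∀ k : Fin n, Y k ω = y k} = 0
  · simp [hy]
  · rw [mul_assoc]
    exact mul_le_mul_of_nonneg_left (h.isObserved hXY hy).sum_prod_mul_empiricalLength_le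
      measureReal_nonneg

theorem integral_neg_empiricalLength_le [IsProbabilityMeasure μ] (hXY : IsIncompleteSource μ X Y)
    (h : IsFeature μ X Y v t P) (n : ℕ) :
    ∫ ω, -empiricalLength (counts v (frame X n ω)) ∂μ ≤
      -(n * (μ.real {ω | t (Y 0 ω)} * ∑ a, Real.negMulLog (P a))) + Fintype.card A := by
  classical
  -- Total mass one spreads the constant `Fintype.card A` over the pattern sequences, so that the
  -- bound can be proved termwise.
  have h1 : ∑ y : Fin n → Fin p → Bool, μ.real {ω | ∀ k : Fin n, Y k ω = y k} = 1 := by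
    have hY : Measurable fun ω (k : Fin n) => Y k ω :=
      measurable_pi_lambda _ fun k => hXY.measurable_Y k
    have := measureReal_eq_sum (ρ := μ) hY (fun _ => True)
    simpa [funext_iff] using this.symm
  rw [hXY.integral_frame n fun x => -empiricalLength (counts v x), ← mul_assoc,
    ← hXY.sum_pattern_mul_card n t, Finset.sum_mul, ← Finset.sum_neg_distrib,
    ← one_mul (Fintype.card A : ℝ), ← h1, Finset.sum_mul, ← Finset.sum_add_distrib]
  refine Finset.sum_le_sum fun y _ => ?_
  by_cases hy : μ.real {ω | ∀ k : Fin n, Y k ω = y k} = 0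
  · simp [hy]
  · rw [mul_assoc, ← mul_neg, ← mul_add]
    exact mul_le_mul_of_nonneg_left (h.isObserved hXY hy).sum_prod_mul_neg_empiricalLength_le
      measureReal_nonneg

open Classical in
/-- A function of an observed feature is an observed feature. -/
theorem map (hXY : IsIncompleteSource μ X Y) (h : IsFeature μ X Y v t P) (f : A → B) :
    IsFeature μ X Y (fun s => (v s).map f) t
      (fun b => ∑ a, if f a = b then P a else 0) := by
  have key : ∀ y b, (μ[|{ω | Y 0 ω = y}]).real {ω | (v (X 0 ω)).map f = some b} =
      ∑ a, if f a = b then (μ[|{ω | Y 0 ω = y}]).real {ω | v (X 0 ω) = some a} else 0 := by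
    intro y b
    rw [measureReal_eq_sum (hXY.measurable_X 0) (fun s => (v s).map f = some b)]
    simp_rw [fun a => measureReal_eq_sum (ρ := μ[|{ω | Y 0 ω = y}]) (hXY.measurable_X 0)
      (fun s => v s = some a), ← Finset.sum_filter (p := fun a => f a = b)]
    rw [Finset.sum_comm]
    refine Finset.sum_congr rfl fun s _ => ?_
    rcases hs : v s with _ | a
    · simp
    · simp [Finset.sum_ite_eq]
  refine ⟨fun b => Finset.sum_nonneg fun a _ => ?_, fun y hy ht => ?_, fun y hy ht b => ?_,
    fun y hy ht b => ?_⟩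
  · split_ifs
    exacts [h.nonneg a, le_rfl]
  · rw [Finset.sum_comm, ← h.sum_eq_one y hy ht]
    simp
  · rw [key]
    simp_rw [h.law_pos y hy ht]
  · rw [key]
    simp_rw [h.law_neg y hy ht]
    simp

end IsFeature

end Source

/-! ### The laws of single entries and of pairs of entries -/

section Laws

variable {p : ℕ} {α : Fin p → ℕ}

/-- Entry `i` of a sample, if it is observed. -/
def entry (i : Fin p) (s : Row α) : Option (Fin (α i)) :=
  if h : s i = Fin.last (α i) then none else some ((s i).castPred h)

theorem entry_eq_some {i : Fin p} {s : Row α} {a : Fin (α i)} :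
    entry i s = some a ↔ s i = a.castSucc := by
  rw [entry]
  split_ifs with h
  · simp only [false_iff, h]
    exact (Fin.castSucc_ne_last a).symm
  · rw [Option.some.injEq]
    exact ⟨fun h' => by rw [← h', Fin.castSucc_castPred], fun h' => by simp [h']⟩

theorem entry_eq_none {i : Fin p} {s : Row α} : entry i s = none ↔ s i = Fin.last (α i) := by
  rw [entry]
  split_ifs with h <;> simp [h]

/-- Entries `i` and `j` of a sample, if both are observed. -/
def pairEntry (i j : Fin p) (s : Row α) : Option (Fin (α i) × Fin (α j)) :=
  (entry i s).bind fun a => (entry j s).map fun b => (a, b)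

theorem pairEntry_eq_some {i j : Fin p} {s : Row α} {ab : Fin (α i) × Fin (α j)} :
    pairEntry i j s = some ab ↔ s i = ab.1.castSucc ∧ s j = ab.2.castSucc := by
  obtain ⟨a, b⟩ := ab
  simp only [pairEntry, Option.bind_eq_some_iff, Option.map_eq_some_iff, Prod.mk.injEq,
    entry_eq_some]
  constructor
  · rintro ⟨a', h1, b', h2, rfl, rfl⟩
    exact ⟨h1, h2⟩
  · rintro ⟨h1, h2⟩
    exact ⟨a, h1, b, h2, rfl, rfl⟩

theorem pairEntry_eq_none {i j : Fin p} {s : Row α} :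
    pairEntry i j s = none ↔ s i = Fin.last (α i) ∨ s j = Fin.last (α j) := by
  rw [← entry_eq_none, ← entry_eq_none, pairEntry]
  cases entry i s <;> cases entry j s <;> simp

variable {Ω : Type*} [MeasurableSpace Ω] {μ : Measure Ω}
  {X : ℕ → Ω → Row α} {Y : ℕ → Ω → Fin p → Bool}

theorem condReal_eq_zero {C B : Set Ω} (hC : MeasurableSet C) (h : ∀ ω ∈ C, ω ∉ B) :
    (μ[|C]).real B = 0 := by
  have : C ∩ B = ∅ := by
    ext ω
    simpa using h ω
  simp [Measure.real, cond_apply hC, this]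

theorem P_eq_P₂ (i : Fin p) (a : Fin (α i + 1)) : P μ X Y i a = P₂ μ X Y i i a a := by
  simp [P, P₂]

theorem P₂_comm (i j : Fin p) (a : Fin (α i + 1)) (b : Fin (α j + 1)) :
    P₂ μ X Y j i b a = P₂ μ X Y i j a b := by
  simp only [P₂, and_comm]

theorem PatternFree.symm {i j : Fin p} (h : PatternFree μ X Y i j) : PatternFree μ X Y j i := by
  intro y hj hi hy b a
  rw [P₂_comm, ← h y hi hj hy a b]
  simp only [and_comm]

theorem P₂_nonneg (i j : Fin p) (a : Fin (α i + 1)) (b : Fin (α j + 1)) : 0 ≤ P₂ μ X Y i j a b :=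
  measureReal_nonneg

theorem IsIncompleteSource.measurableSet_pattern (h : IsIncompleteSource μ X Y)
    (t : (Fin p → Bool) → Prop) : MeasurableSet {ω | t (Y 0 ω)} :=
  h.measurable_Y 0 (Set.toFinite {y | t y}).measurableSet

theorem IsIncompleteSource.measurable_entry (h : IsIncompleteSource μ X Y) (i : Fin p) :
    Measurable fun ω => X 0 ω i := (measurable_pi_apply i).comp (h.measurable_X 0)

theorem P₂_last_left (h : IsIncompleteSource μ X Y) (i j : Fin p) (b : Fin (α j + 1)) :
    P₂ μ X Y i j (Fin.last _) b = 0 := by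
  refine condReal_eq_zero (h.measurableSet_pattern fun y => y i = true ∧ y j = true)
    fun ω hω hω' => ?_
  have h1 := (h.missing_iff 0 ω i).1 hω'.1
  have h2 : Y 0 ω i = true := hω.1
  simp [h1] at h2

theorem P₂_last_right (h : IsIncompleteSource μ X Y) (i j : Fin p) (a : Fin (α i + 1)) :
    P₂ μ X Y i j a (Fin.last _) = 0 := by
  rw [← P₂_comm, P₂_last_left h]

theorem P_last (h : IsIncompleteSource μ X Y) (i : Fin p) : P μ X Y i (Fin.last _) = 0 := by
  rw [P_eq_P₂, P₂_last_left h]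

theorem sum_P₂ (h : IsIncompleteSource μ X Y) (i j : Fin p) (a : Fin (α i + 1)) :
    ∑ b, P₂ μ X Y i j a b = Psub μ X Y i j a := by
  classical
  have h1 := measureReal_eq_sum (ρ := μ[|{ω | Y 0 ω i = true ∧ Y 0 ω j = true}])
    ((h.measurable_entry i).prodMk (h.measurable_entry j)) (fun z => z.1 = a)
  rw [Fintype.sum_prod_type, Finset.sum_eq_single a] at h1
  · rw [Psub, h1]
    refine Finset.sum_congr rfl fun b _ => ?_
    simp [P₂, Prod.mk.injEq]
  · intro a' _ ha'
    simp [ha']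
  · simp

theorem Psub_last (h : IsIncompleteSource μ X Y) (i j : Fin p) :
    Psub μ X Y i j (Fin.last _) = 0 := by
  rw [← sum_P₂ h]
  exact Finset.sum_eq_zero fun b _ => P₂_last_left h i j b

theorem P₂_eq_zero_of_Psub (h : IsIncompleteSource μ X Y) {i j : Fin p} {a : Fin (α i + 1)}
    (ha : Psub μ X Y i j a = 0) (b : Fin (α j + 1)) : P₂ μ X Y i j a b = 0 := by
  rw [← sum_P₂ h, Finset.sum_eq_zero_iff_of_nonneg fun b _ => P₂_nonneg i j a b] at ha
  exact ha b (Finset.mem_univ b)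

/-- Mutual information as two marginal entropies minus the joint one, matching the three Bayes
measures of an edge. The missing symbol has probability zero and drops out. -/
theorem I_eq (h : IsIncompleteSource μ X Y) (i j : Fin p) :
    I μ X Y i j = ∑ a : Fin (α i), Real.negMulLog (Psub μ X Y i j a.castSucc) +
      ∑ b : Fin (α j), Real.negMulLog (Psub μ X Y j i b.castSucc) -
      ∑ ab : Fin (α i) × Fin (α j),
        Real.negMulLog (P₂ μ X Y i j ab.1.castSucc ab.2.castSucc) := by
  have h1 : ∀ a b, P₂ μ X Y i j a b *
      Real.log (P₂ μ X Y i j a b / (Psub μ X Y i j a * Psub μ X Y j i b)) =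
      P₂ μ X Y i j a b * -Real.log (Psub μ X Y i j a) +
      P₂ μ X Y i j a b * -Real.log (Psub μ X Y j i b) - Real.negMulLog (P₂ μ X Y i j a b) := by
    intro a b
    by_cases h0 : P₂ μ X Y i j a b = 0
    · simp [h0]
    · have ha : Psub μ X Y i j a ≠ 0 := fun h' => h0 (P₂_eq_zero_of_Psub h h' b)
      have hb : Psub μ X Y j i b ≠ 0 := fun h' => h0 (by
        rw [← P₂_comm]
        exact P₂_eq_zero_of_Psub h h' a)
      rw [Real.log_div h0 (mul_ne_zero ha hb), Real.log_mul ha hb, Real.negMulLog]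
      ring
  have h2 : ∑ a, ∑ b, P₂ μ X Y i j a b * -Real.log (Psub μ X Y i j a) =
      ∑ a : Fin (α i), Real.negMulLog (Psub μ X Y i j a.castSucc) := by
    simp_rw [← Finset.sum_mul, sum_P₂ h]
    rw [Fin.sum_univ_castSucc, Psub_last h, zero_mul, add_zero]
    exact Finset.sum_congr rfl fun a _ => by rw [Real.negMulLog]; ring
  have h3 : ∑ a, ∑ b, P₂ μ X Y i j a b * -Real.log (Psub μ X Y j i b) =
      ∑ b : Fin (α j), Real.negMulLog (Psub μ X Y j i b.castSucc) := by
    rw [Finset.sum_comm]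
    simp_rw [← P₂_comm i j, ← Finset.sum_mul, sum_P₂ h]
    rw [Fin.sum_univ_castSucc, Psub_last h, zero_mul, add_zero]
    exact Finset.sum_congr rfl fun a _ => by rw [Real.negMulLog]; ring
  have h4 : ∑ a, ∑ b, Real.negMulLog (P₂ μ X Y i j a b) =
      ∑ ab : Fin (α i) × Fin (α j),
        Real.negMulLog (P₂ μ X Y i j ab.1.castSucc ab.2.castSucc) := by
    rw [Fintype.sum_prod_type, Fin.sum_univ_castSucc]
    simp only [P₂_last_left h, Real.negMulLog_zero, Finset.sum_const_zero, add_zero]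
    refine Finset.sum_congr rfl fun a _ => ?_
    rw [Fin.sum_univ_castSucc, P₂_last_right h, Real.negMulLog_zero, add_zero]
  simp only [I, h1, Finset.sum_add_distrib, Finset.sum_sub_distrib]
  rw [h2, h3, h4]

/-- Under pattern-freeness, conditioning on a second observed entry does not change the law of
an entry. -/
theorem Psub_eq_P (h : IsIncompleteSource μ X Y) {y : Fin p → Bool}
    (hy : μ.real {ω | Y 0 ω = y} ≠ 0) {i j : Fin p} (hi : y i = true) (hj : y j = true)
    (hii : PatternFree μ X Y i i) (hij : PatternFree μ X Y i j) (a : Fin (α i + 1)) :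
    Psub μ X Y i j a = P μ X Y i a := by
  classical
  have hy' : μ {ω | Y 0 ω = y} ≠ 0 := fun h => hy (by simp [Measure.real, h])
  rw [← sum_P₂ h, P_eq_P₂, ← hii y hi hi hy' a a]
  simp_rw [← hij y hi hj hy' a, and_self]
  have h1 := measureReal_eq_sum (ρ := μ[|{ω | Y 0 ω = y}])
    ((h.measurable_entry i).prodMk (h.measurable_entry j)) (fun z => z.1 = a)
  rw [Fintype.sum_prod_type, Finset.sum_eq_single a] at h1
  · rw [h1]
    refine Finset.sum_congr rfl fun b _ => ?_
    simp [Prod.mk.injEq]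
  · intro a' _ ha'
    simp [ha']
  · simp

theorem sum_condReal_entry [IsFiniteMeasure μ] (h : IsIncompleteSource μ X Y) {C : Set Ω}
    (hC : μ.real C ≠ 0) (i : Fin p) : ∑ a, (μ[|C]).real {ω | X 0 ω i = a} = 1 := by
  classical
  have : IsProbabilityMeasure (μ[|C]) :=
    cond_isProbabilityMeasure fun h => hC (by simp [Measure.real, h])
  have h1 := measureReal_eq_sum (ρ := μ[|C]) (h.measurable_entry i) (fun _ => True)
  simp only [Set.ofPred_true, probReal_univ, if_true] at h1
  exact h1.symm

theorem pattern_event_ne_zero [IsFiniteMeasure μ] {y : Fin p → Bool}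
    (hy : μ.real {ω | Y 0 ω = y} ≠ 0) {t : (Fin p → Bool) → Prop} (ht : t y) :
    μ.real {ω | t (Y 0 ω)} ≠ 0 := by
  intro h0
  refine hy (le_antisymm ?_ measureReal_nonneg)
  rw [← h0]
  refine measureReal_mono fun ω hω => ?_
  have : Y 0 ω = y := hω
  simpa [this] using ht

variable [IsProbabilityMeasure μ]

theorem sum_P (h : IsIncompleteSource μ X Y) {y : Fin p → Bool}
    (hy : μ.real {ω | Y 0 ω = y} ≠ 0) {i : Fin p} (hi : y i = true) : ∑ a, P μ X Y i a = 1 :=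
  sum_condReal_entry h (pattern_event_ne_zero hy (t := fun y => y i = true) hi) i

theorem sum_Psub (h : IsIncompleteSource μ X Y) {y : Fin p → Bool}
    (hy : μ.real {ω | Y 0 ω = y} ≠ 0) {i j : Fin p} (hi : y i = true) (hj : y j = true) :
    ∑ a, Psub μ X Y i j a = 1 :=
  sum_condReal_entry h
    (pattern_event_ne_zero hy (t := fun y => y i = true ∧ y j = true) ⟨hi, hj⟩) i

theorem isFeature_entry (h : IsIncompleteSource μ X Y) {i : Fin p} (hi : PatternFree μ X Y i i) :
    IsFeature μ X Y (entry i) (fun y => y i = true) (fun a => P μ X Y i a.castSucc) where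
  nonneg a := measureReal_nonneg
  sum_eq_one y hy ht := by
    rw [← sum_P h hy ht, Fin.sum_univ_castSucc, P_last h, add_zero]
  law_pos y hy ht a := by
    have hy' : μ {ω | Y 0 ω = y} ≠ 0 := fun h => hy (by simp [Measure.real, h])
    have := hi y ht ht hy' a.castSucc a.castSucc
    rw [← P_eq_P₂] at this
    simpa only [entry_eq_some, and_self] using this
  law_neg y hy ht a := by
    refine condReal_eq_zero (h.measurableSet_pattern fun z => z = y) fun ω hω hω' => ?_
    have h1 : Y 0 ω = y := hω
    have h2 := entry_eq_some.1 hω'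
    have h3 := (h.missing_iff 0 ω i).2 (by simpa [h1] using ht)
    exact Fin.castSucc_ne_last a (h2.symm.trans h3)

theorem isFeature_pairEntry (h : IsIncompleteSource μ X Y) {i j : Fin p}
    (hij : PatternFree μ X Y i j) :
    IsFeature μ X Y (pairEntry i j) (fun y => y i = true ∧ y j = true)
      (fun ab => P₂ μ X Y i j ab.1.castSucc ab.2.castSucc) where
  nonneg a := measureReal_nonneg
  sum_eq_one y hy ht := by
    rw [← sum_Psub h hy ht.1 ht.2, Fin.sum_univ_castSucc, Psub_last h, add_zero,
      Fintype.sum_prod_type]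
    refine Finset.sum_congr rfl fun a _ => ?_
    rw [← sum_P₂ h, Fin.sum_univ_castSucc, P₂_last_right h, add_zero]
  law_pos y hy ht a := by
    have hy' : μ {ω | Y 0 ω = y} ≠ 0 := fun h => hy (by simp [Measure.real, h])
    simpa only [pairEntry_eq_some] using hij y ht.1 ht.2 hy' a.1.castSucc a.2.castSucc
  law_neg y hy ht a := by
    refine condReal_eq_zero (h.measurableSet_pattern fun z => z = y) fun ω hω hω' => ?_
    have h1 : Y 0 ω = y := hω
    have h2 := pairEntry_eq_some.1 hω'
    refine ht ⟨?_, ?_⟩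
    · by_contra hi
      have h3 := (h.missing_iff 0 ω i).2 (by simpa [h1] using hi)
      exact Fin.castSucc_ne_last _ (h2.1.symm.trans h3)
    · by_contra hj
      have h3 := (h.missing_iff 0 ω j).2 (by simpa [h1] using hj)
      exact Fin.castSucc_ne_last _ (h2.2.symm.trans h3)

/-- The first entry is treated as a function of the observed pair; the second one follows by
swapping `i` and `j`. -/
theorem isFeature_pairEntry_fst (h : IsIncompleteSource μ X Y) {i j : Fin p}
    (hij : PatternFree μ X Y i j) :
    IsFeature μ X Y (fun s => (pairEntry i j s).map Prod.fst)
      (fun y => y i = true ∧ y j = true) (fun a => Psub μ X Y i j a.castSucc) := by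
  classical
  convert (isFeature_pairEntry h hij).map h Prod.fst using 2 with a
  rw [← sum_P₂ h, Fin.sum_univ_castSucc, P₂_last_right h, add_zero, Fintype.sum_prod_type,
    Finset.sum_eq_single a]
  · simp
  · intro a' _ ha'
    simp [ha']
  · simp

/-- The conditional entropy of the forest distribution given the missingness pattern. -/
theorem condEntropy_eq (h : IsIncompleteSource μ X Y) {E : Finset (Fin p × Fin p)}
    (hE : IsForest E) (hV : ∀ i, PatternFree μ X Y i i)
    (hP : ∀ e ∈ E, PatternFree μ X Y e.1 e.2) :
    condEntropy μ X Y E =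
      ∑ i, r μ Y i * H μ X Y i - ∑ e ∈ E, r₂ μ Y e.1 e.2 * I μ X Y e.1 e.2 := by
  classical
  have key : ∀ y, μ.real {ω | Y 0 ω = y} ≠ 0 →
      ∑ x ∈ Finset.univ.filter (fun x : Row α => ∀ i, x i = Fin.last (α i) ↔ y i = false),
        Real.negMulLog (P' μ X Y E x y) =
      ∑ i, (if y i = true then H μ X Y i else 0) -
        ∑ e ∈ E, if y e.1 = true ∧ y e.2 = true then I μ X Y e.1 e.2 else 0 := by
    intro y hy
    -- Missing entries get a point mass at the missing symbol, so the sum over compatible samples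
    -- becomes a sum over all samples.
    let m : ∀ i, Fin (α i + 1) → ℝ := fun i a =>
      if y i = true then P μ X Y i a else if a = Fin.last (α i) then 1 else 0
    let g : ∀ e : Fin p × Fin p, Fin (α e.1 + 1) → Fin (α e.2 + 1) → ℝ := fun e a b =>
      P₂ μ X Y e.1 e.2 a b / (P μ X Y e.1 a * P μ X Y e.2 b)
    let D := E.filter fun e => y e.1 = true ∧ y e.2 = true
    have hm1 : ∀ i, y i = true → m i = P μ X Y i := fun i hi => by
      funext a
      simp [m, hi]
    have hm : ∀ i, ∑ a, m i a = 1 := by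
      intro i
      by_cases hi : y i = true
      · rw [hm1 i hi, sum_P h hy hi]
      · simp [m, hi]
    have hsub : ∀ e ∈ D, (∀ a, Psub μ X Y e.1 e.2 a = P μ X Y e.1 a) ∧
        ∀ b, Psub μ X Y e.2 e.1 b = P μ X Y e.2 b := by
      intro e he
      obtain ⟨heE, h1, h2⟩ := Finset.mem_filter.1 he
      exact ⟨Psub_eq_P h hy h1 h2 (hV _) (hP e heE), Psub_eq_P h hy h2 h1 (hV _) (hP e heE).symm⟩
    -- Division by a vanishing marginal does no harm: the joint probability vanishes there too.
    have hmg : ∀ e ∈ D, ∀ a b, m e.1 a * m e.2 b * g e a b = P₂ μ X Y e.1 e.2 a b := by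
      intro e he a b
      obtain ⟨heE, h1, h2⟩ := Finset.mem_filter.1 he
      simp only [hm1 _ h1, hm1 _ h2, g]
      by_cases ha : P μ X Y e.1 a = 0
      · rw [← (hsub e he).1] at ha
        simp [P₂_eq_zero_of_Psub h ha]
      by_cases hb : P μ X Y e.2 b = 0
      · rw [← (hsub e he).2] at hb
        rw [← P₂_comm]
        simp [P₂_eq_zero_of_Psub h hb]
      field_simp
    have hg : IsCoupling m g D := by
      intro e he
      obtain ⟨heE, h1, h2⟩ := Finset.mem_filter.1 he
      constructor
      · intro a ha
        refine mul_left_cancel₀ ha ?_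
        rw [Finset.mul_sum, mul_one]
        simp_rw [← mul_assoc, hmg e he]
        rw [sum_P₂ h, (hsub e he).1, hm1 _ h1]
      · intro b hb
        refine mul_left_cancel₀ hb ?_
        rw [Finset.mul_sum, mul_one]
        simp_rw [← mul_assoc, mul_comm (m e.2 b), hmg e he, ← P₂_comm e.1 e.2]
        rw [sum_P₂ h, (hsub e he).2, hm1 _ h2]
    have hD : IsForest D := hE.subset (Finset.filter_subset _ _)
    have hent := sum_negMulLog_forestWeight hm hD hg
    have hsum : ∑ x ∈ Finset.univ.filter
          (fun x : Row α => ∀ i, x i = Fin.last (α i) ↔ y i = false),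
        Real.negMulLog (P' μ X Y E x y) = ∑ x, Real.negMulLog (forestWeight m g D x) := by
      rw [Finset.sum_filter]
      refine Finset.sum_congr rfl fun x _ => ?_
      split_ifs with hx
      · congr 1
        rw [P', forestWeight]
        congr 1
        · refine Finset.prod_congr rfl fun i _ => ?_
          rcases hi : y i with _ | _
          · simp [m, hi, (hx i).2 hi]
          · simp [m, hi]
        · rw [Finset.prod_filter]
          refine Finset.prod_congr rfl fun e _ => ?_
          rcases h1 : y e.1 <;> rcases h2 : y e.2 <;> simp [g]
      -- A sample incompatible with `y` has a vertex weight equal to zero.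
      · obtain ⟨i, hi⟩ := not_forall.1 hx
        rw [forestWeight_eq_zero (i := i), Real.negMulLog_zero]
        rcases hyi : y i with _ | _
        · have : x i ≠ Fin.last (α i) := fun h' => hi (by simp [h', hyi])
          simp [m, hyi, this]
        · have : x i = Fin.last (α i) := by
            by_contra h'
            exact hi (by simp [h', hyi])
          simp [m, hyi, this, P_last h]
    rw [hsum, hent]
    congr 1
    · refine Finset.sum_congr rfl fun i _ => ?_
      split_ifs with hi
      · rw [hm1 i hi, H]
      · refine Finset.sum_eq_zero fun a _ => ?_
        by_cases ha : a = Fin.last (α i) <;> simp [m, hi, ha]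
    · rw [Finset.sum_filter]
      refine Finset.sum_congr rfl fun e he => ?_
      split_ifs with hye
      · have heD : e ∈ D := Finset.mem_filter.2 ⟨he, hye⟩
        rw [I]
        simp_rw [hmg e heD, (hsub e heD).1, (hsub e heD).2]
        rfl
      · rfl
  have hterm : ∀ y, μ.real {ω | Y 0 ω = y} *
      ∑ x ∈ Finset.univ.filter (fun x : Row α => ∀ i, x i = Fin.last (α i) ↔ y i = false),
        Real.negMulLog (P' μ X Y E x y) =
      ∑ i, (if y i = true then μ.real {ω | Y 0 ω = y} else 0) * H μ X Y i -
        ∑ e ∈ E, (if y e.1 = true ∧ y e.2 = true then μ.real {ω | Y 0 ω = y} else 0) *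
          I μ X Y e.1 e.2 := by
    intro y
    by_cases hy : μ.real {ω | Y 0 ω = y} = 0
    · simp [hy]
    · rw [key y hy, mul_sub, Finset.mul_sum, Finset.mul_sum]
      simp only [mul_ite, ite_mul, mul_zero, zero_mul]
  rw [condEntropy, Finset.sum_congr rfl fun y _ => hterm y, Finset.sum_sub_distrib,
    Finset.sum_comm, Finset.sum_comm (t := E)]
  congr 1
  · refine Finset.sum_congr rfl fun i _ => ?_
    rw [← Finset.sum_mul, r, measureReal_eq_sum (h.measurable_Y 0) (fun y => y i = true)]
    congr!
  · refine Finset.sum_congr rfl fun e _ => ?_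
    rw [← Finset.sum_mul, r₂,
      measureReal_eq_sum (h.measurable_Y 0) (fun y => y e.1 = true ∧ y e.2 = true)]
    congr!

end Laws

/-! ### The redundancy bound -/

section Redundancy

variable {p : ℕ} {α : Fin p → ℕ} {n : ℕ}

theorem Q_eq (x : Fin n → Row α) (i : Fin p) : Q x i = bayesMeasure (counts (entry i) x) := by
  classical
  rw [Q]
  congr 1
  funext a
  rw [counts, obs, Finset.filter_filter]
  congr 1
  ext k
  simp only [Finset.mem_filter, Finset.mem_univ, true_and, entry_eq_some, and_iff_right_iff_imp]
  intro h
  rw [h]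
  exact Fin.castSucc_ne_last a

theorem Qpair_eq (x : Fin n → Row α) (i j : Fin p) :
    Qpair x i j = bayesMeasure (counts (pairEntry i j) x) := by
  classical
  rw [Qpair]
  congr 1
  funext a
  rw [counts, obs₂, Finset.filter_filter]
  congr 1
  ext k
  simp only [Finset.mem_filter, Finset.mem_univ, true_and, pairEntry_eq_some,
    and_iff_right_iff_imp]
  intro h
  rw [h.1, h.2]
  exact ⟨Fin.castSucc_ne_last _, Fin.castSucc_ne_last _⟩

theorem Qsub_eq (x : Fin n → Row α) (i j : Fin p) :
    Qsub x i j = bayesMeasure (counts (fun s => (pairEntry i j s).map Prod.fst) x) := by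
  classical
  rw [Qsub]
  congr 1
  funext a
  rw [counts, obs₂, Finset.filter_filter]
  congr 1
  ext k
  simp only [Finset.mem_filter, Finset.mem_univ, true_and, Option.map_eq_some_iff,
    pairEntry_eq_some]
  constructor
  · rintro ⟨⟨-, h2⟩, h3⟩
    exact ⟨(a, (x k j).castPred h2), ⟨h3, by simp⟩, rfl⟩
  · rintro ⟨⟨a', b⟩, ⟨h1, h2⟩, rfl⟩
    rw [h1, h2]
    exact ⟨⟨Fin.castSucc_ne_last _, Fin.castSucc_ne_last _⟩, rfl⟩

theorem sum_counts_entry (x : Fin n → Row α) (i : Fin p) :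
    ∑ a, counts (entry i) x a = (obs x i).card := by
  classical
  rw [sum_counts, obs]
  congr 1
  ext k
  simp [entry_eq_none]

theorem sum_counts_pairEntry (x : Fin n → Row α) (i j : Fin p) :
    ∑ a, counts (pairEntry i j) x a = (obs₂ x i j).card := by
  classical
  rw [sum_counts, obs₂]
  congr 1
  ext k
  simp [pairEntry_eq_none]

theorem sum_counts_pairEntry_fst (x : Fin n → Row α) (i j : Fin p) :
    ∑ a, counts (fun s => (pairEntry i j s).map Prod.fst) x a = (obs₂ x i j).card := by
  classical
  rw [sum_counts, obs₂]
  congr 1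
  ext k
  simp [pairEntry_eq_none]

theorem obs₂_comm (x : Fin n → Row α) (i j : Fin p) : obs₂ x j i = obs₂ x i j := by
  simp only [obs₂, and_comm]

theorem nonempty_fin (hα : ∀ i, 2 ≤ α i) (i : Fin p) : Nonempty (Fin (α i)) :=
  ⟨⟨0, by linarith [hα i]⟩⟩

/-- The length of a code for entry `i` of the data frame, up to a bounded error. -/
noncomputable def entryLength (x : Fin n → Row α) (i : Fin p) : ℝ :=
  empiricalLength (counts (entry i) x) +
    ((α i : ℝ) - 1) / 2 * Real.log ((obs x i).card : ℝ)

/-- The change of the code length that is due to the edge between `i` and `j`, up to a bounded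
error. -/
noncomputable def edgeLength (x : Fin n → Row α) (i j : Fin p) : ℝ :=
  empiricalLength (counts (pairEntry i j) x) +
    -empiricalLength (counts (fun s => (pairEntry i j s).map Prod.fst) x) +
    -empiricalLength (counts (fun s => (pairEntry j i s).map Prod.fst) x) +
    ((α i : ℝ) - 1) * ((α j : ℝ) - 1) / 2 * Real.log ((obs₂ x i j).card : ℝ)

theorem exists_neg_log_Q_le (hα : ∀ i, 2 ≤ α i) (i : Fin p) :
    ∃ K : ℝ, ∀ (n : ℕ) (x : Fin n → Row α), -Real.log (Q x i) ≤
      entryLength x i + K := by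
  have := nonempty_fin hα i
  obtain ⟨K, hK⟩ := exists_abs_log_bayesMeasure_le (Fin (α i))
  refine ⟨K, fun n x => ?_⟩
  have h := (abs_le.1 (hK (counts (entry i) x))).1
  rw [sum_counts_entry, ← Q_eq, Fintype.card_fin] at h
  rw [entryLength]
  linarith

/-- The factor of `Rⁿ` that belongs to the pair `i`, `j`. -/
noncomputable def edgeRatio (x : Fin n → Row α) (i j : Fin p) : ℝ :=
  Qpair x i j / (Qsub x i j * Qsub x j i)

theorem edgeRatio_pos (hα : ∀ i, 2 ≤ α i) (x : Fin n → Row α) (i j : Fin p) :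
    0 < edgeRatio x i j := by
  have := nonempty_fin hα i
  have := nonempty_fin hα j
  rw [edgeRatio, Qpair_eq, Qsub_eq, Qsub_eq]
  exact div_pos (bayesMeasure_pos _) (mul_pos (bayesMeasure_pos _) (bayesMeasure_pos _))

/-- The joint and marginal half-dimensions combine by `(α i * α j - 1) - (α i - 1) - (α j - 1) = (α
i - 1) * (α j - 1)`. -/
theorem exists_neg_log_edgeRatio_le (hα : ∀ i, 2 ≤ α i) (i j : Fin p) :
    ∃ K : ℝ, ∀ (n : ℕ) (x : Fin n → Row α), -Real.log (edgeRatio x i j) ≤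
      edgeLength x i j + K := by
  have := nonempty_fin hα i
  have := nonempty_fin hα j
  obtain ⟨K₁, hK₁⟩ := exists_abs_log_bayesMeasure_le (Fin (α i))
  obtain ⟨K₂, hK₂⟩ := exists_abs_log_bayesMeasure_le (Fin (α j))
  obtain ⟨K₃, hK₃⟩ := exists_abs_log_bayesMeasure_le (Fin (α i) × Fin (α j))
  refine ⟨K₁ + K₂ + K₃, fun n x => ?_⟩
  have h1 := (abs_le.1 (hK₁ (counts (fun s => (pairEntry i j s).map Prod.fst) x))).2
  have h2 := (abs_le.1 (hK₂ (counts (fun s => (pairEntry j i s).map Prod.fst) x))).2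
  have h3 := (abs_le.1 (hK₃ (counts (pairEntry i j) x))).1
  rw [sum_counts_pairEntry_fst, Fintype.card_fin] at h1 h2
  rw [sum_counts_pairEntry, Fintype.card_prod, Fintype.card_fin, Fintype.card_fin] at h3
  rw [obs₂_comm] at h2
  rw [edgeRatio, Qpair_eq, Qsub_eq, Qsub_eq, Real.log_div (bayesMeasure_pos _).ne'
    (mul_pos (bayesMeasure_pos _) (bayesMeasure_pos _)).ne',
    Real.log_mul (bayesMeasure_pos _).ne' (bayesMeasure_pos _).ne']
  push_cast at h3
  rw [edgeLength]
  linarith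

theorem log_R (hα : ∀ i, 2 ≤ α i) (x : Fin n → Row α) (E : Finset (Fin p × Fin p)) :
    Real.log (R x E) = ∑ i, Real.log (Q x i) + ∑ e ∈ E, Real.log (edgeRatio x e.1 e.2) := by
  have hQ : ∀ i, Q x i ≠ 0 := fun i => by
    have := nonempty_fin hα i
    rw [Q_eq]
    exact (bayesMeasure_pos _).ne'
  have hR : ∀ e ∈ E, edgeRatio x e.1 e.2 ≠ 0 := fun e _ => (edgeRatio_pos hα x e.1 e.2).ne'
  have hRE : R x E = (∏ i, Q x i) * ∏ e ∈ E, edgeRatio x e.1 e.2 := rfl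
  rw [hRE, Real.log_mul (Finset.prod_ne_zero_iff.2 fun i _ => hQ i)
    (Finset.prod_ne_zero_iff.2 hR), Real.log_prod fun i _ => hQ i, Real.log_prod hR]

/-- The Chow–Liu forest of the weights `Jⁿ` minimizes the description length. -/
theorem descriptionLength_le (hα : ∀ i, 2 ≤ α i) (hn : 1 ≤ n) {x : Fin n → Row α}
    {E E' : Finset (Fin p × Fin p)}
    (hE' : IsChowLiu (J x) E') (hE : IsForest E) :
    descriptionLength x E' ≤ descriptionLength x E := by
  have h := hE'.sum_le hE
  simp only [J, ← Finset.mul_sum] at h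
  have hn' : (0 : ℝ) < 1 / n := by positivity
  have h' := le_of_mul_le_mul_left h hn'
  simp only [descriptionLength, log_R hα, edgeRatio]
  linarith

theorem exists_descriptionLength_le (hα : ∀ i, 2 ≤ α i) (E : Finset (Fin p × Fin p)) :
    ∃ K : ℝ, ∀ (n : ℕ) (x : Fin n → Row α), descriptionLength x E ≤
      ∑ i, entryLength x i + ∑ e ∈ E, edgeLength x e.1 e.2 + K := by
  choose K₁ hK₁ using exists_neg_log_Q_le hα
  choose K₂ hK₂ using exists_neg_log_edgeRatio_le hα
  refine ⟨Real.log (numForests p) + ∑ i, K₁ i + ∑ e ∈ E, K₂ e.1 e.2, fun n x => ?_⟩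
  have h1 := Finset.sum_le_sum fun i (_ : i ∈ Finset.univ) => hK₁ i n x
  have h2 := Finset.sum_le_sum fun e (_ : e ∈ E) => hK₂ e.1 e.2 n x
  rw [Finset.sum_add_distrib, Finset.sum_neg_distrib] at h1 h2
  rw [descriptionLength, log_R hα]
  linarith

/-! ### Expected code lengths -/

variable {Ω : Type*} [MeasurableSpace Ω] {μ : Measure Ω} [IsProbabilityMeasure μ]
  {X : ℕ → Ω → Row α} {Y : ℕ → Ω → Fin p → Bool}

theorem integral_entryLength_le (h : IsIncompleteSource μ X Y) {i : Fin p}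
    (hi : PatternFree μ X Y i i) (n : ℕ) :
    ∫ ω, entryLength (frame X n ω) i ∂μ ≤ n * (r μ Y i * H μ X Y i) +
      ((α i : ℝ) - 1) / 2 * ∫ ω, Real.log ((obs (frame X n ω) i).card : ℝ) ∂μ := by
  have hint : ∀ f : (Fin n → Row α) → ℝ, Integrable (fun ω => f (frame X n ω)) μ := fun f =>
    integrable_comp_finite (h.measurable_frame n) f
  have h1 := (isFeature_entry h hi).integral_empiricalLength_le h n
  simp only [entryLength]
  rw [integral_add (hint fun x => empiricalLength (counts (entry i) x))
    (hint fun x => ((α i : ℝ) - 1) / 2 * Real.log ((obs x i).card : ℝ)), integral_const_mul,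
    H, Fin.sum_univ_castSucc, P_last h, Real.negMulLog_zero, add_zero]
  exact add_le_add h1 le_rfl

/-- The joint length is bounded above by Gibbs' inequality; the subtracted marginal lengths need the
chi-squared bound, which costs `α i + α j`. The entropies combine by `I_eq`. -/
theorem integral_edgeLength_le (h : IsIncompleteSource μ X Y) {i j : Fin p}
    (hij : PatternFree μ X Y i j) (n : ℕ) :
    ∫ ω, edgeLength (frame X n ω) i j ∂μ ≤
      -(n * (r₂ μ Y i j * I μ X Y i j)) + (α i + α j) +
      ((α i : ℝ) - 1) * ((α j : ℝ) - 1) / 2 *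
        ∫ ω, Real.log ((obs₂ (frame X n ω) i j).card : ℝ) ∂μ := by
  have hint : ∀ f : (Fin n → Row α) → ℝ, Integrable (fun ω => f (frame X n ω)) μ := fun f =>
    integrable_comp_finite (h.measurable_frame n) f
  have h1 := (isFeature_pairEntry h hij).integral_empiricalLength_le h n
  have h2 := (isFeature_pairEntry_fst h hij).integral_neg_empiricalLength_le h n
  have h3 := (isFeature_pairEntry_fst h hij.symm).integral_neg_empiricalLength_le h n
  simp only [and_comm (a := Y 0 _ j = true)] at h3
  rw [Fintype.card_fin] at h2 h3
  have i1 := hint fun x => empiricalLength (counts (pairEntry i j) x)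
  have i2 := hint fun x => -empiricalLength (counts (fun s => (pairEntry i j s).map Prod.fst) x)
  have i3 := hint fun x => -empiricalLength (counts (fun s => (pairEntry j i s).map Prod.fst) x)
  have i4 := hint fun x => ((α i : ℝ) - 1) * ((α j : ℝ) - 1) / 2 *
    Real.log ((obs₂ x i j).card : ℝ)
  simp only [edgeLength]
  rw [integral_add ((i1.fun_add i2).fun_add i3) i4, integral_add (i1.fun_add i2) i3,
    integral_add i1 i2, integral_const_mul, I_eq h, r₂]
  linarith

/-- The expected description length exceeds `n` times the conditional entropy by logarithmic
terms and a constant only. -/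
theorem exists_integral_descriptionLength_le (hα : ∀ i, 2 ≤ α i) (h : IsIncompleteSource μ X Y)
    {E : Finset (Fin p × Fin p)} (hE : IsForest E)
    {E' : (n : ℕ) → (Fin n → Row α) → Finset (Fin p × Fin p)}
    (hE' : ∀ (n : ℕ) (x : Fin n → Row α), IsChowLiu (J x) (E' n x))
    (hV : ∀ i, PatternFree μ X Y i i) (hP : ∀ e ∈ E, PatternFree μ X Y e.1 e.2) :
    ∃ C : ℝ, ∀ n : ℕ, 1 ≤ n →
      ∫ ω, descriptionLength (frame X n ω) (E' n (frame X n ω)) ∂μ ≤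
        n * (∑ i, r μ Y i * H μ X Y i - ∑ e ∈ E, r₂ μ Y e.1 e.2 * I μ X Y e.1 e.2) +
        ∑ i, ((α i : ℝ) - 1) / 2 * ∫ ω, Real.log ((obs (frame X n ω) i).card : ℝ) ∂μ +
        ∑ e ∈ E, ((α e.1 : ℝ) - 1) * ((α e.2 : ℝ) - 1) / 2 *
          ∫ ω, Real.log ((obs₂ (frame X n ω) e.1 e.2).card : ℝ) ∂μ + C := by
  obtain ⟨K, hK⟩ := exists_descriptionLength_le hα E
  refine ⟨∑ e ∈ E, ((α e.1 : ℝ) + α e.2) + K, fun n hn => ?_⟩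
  have hint : ∀ f : (Fin n → Row α) → ℝ, Integrable (fun ω => f (frame X n ω)) μ := fun f =>
    integrable_comp_finite (h.measurable_frame n) f
  -- The data-dependent forest is replaced here by the fixed forest `E`. Integrability is automatic,
  -- since a frame takes finitely many values.
  have hmono := integral_mono (hint fun x => descriptionLength x (E' n x))
    (hint fun x => ∑ i, entryLength x i + ∑ e ∈ E, edgeLength x e.1 e.2 + K) fun ω =>
    (descriptionLength_le hα hn (hE' n (frame X n ω)) hE).trans (hK n (frame X n ω))
  refine hmono.trans ?_
  have i1 := hint fun x => ∑ i, entryLength x i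
  have i2 := hint fun x => ∑ e ∈ E, edgeLength x e.1 e.2
  rw [integral_add (i1.fun_add i2) (integrable_const _), integral_add i1 i2,
    integral_finsetSum _ fun i _ => hint fun x => entryLength x i,
    integral_finsetSum _ fun e _ => hint fun x => edgeLength x e.1 e.2, integral_const,
    probReal_univ, one_smul]
  have h1 := add_le_add
    (Finset.sum_le_sum fun i (_ : i ∈ Finset.univ) => integral_entryLength_le h (hV i) n)
    (Finset.sum_le_sum fun e he => integral_edgeLength_le h (hP e he) n)
  simp only [Finset.sum_add_distrib, Finset.sum_neg_distrib, ← Finset.mul_sum] at h1 ⊢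
  linarith

end Redundancy

end ForestCoding

open ForestCoding in
theorem theorem2 {p : ℕ} (α : Fin p → ℕ) (hα : ∀ i, 2 ≤ α i)
    {Ω : Type*} [MeasurableSpace Ω] (μ : Measure Ω) [IsProbabilityMeasure μ]
    (X : ℕ → Ω → Row α) (Y : ℕ → Ω → Fin p → Bool) (hXY : IsIncompleteSource μ X Y)
    -- `E` is `E_{X|Y}`, `E' n x` is the `Jⁿ`-forest of the data frame `x`
    (E : Finset (Fin p × Fin p))
    (hE : IsChowLiu (fun i j => r₂ μ Y i j * I μ X Y i j) E)
    (E' : (n : ℕ) → (Fin n → Row α) → Finset (Fin p × Fin p))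
    (hE' : ∀ (n : ℕ) (x : Fin n → Row α), IsChowLiu (J x) (E' n x))
    (hV : ∀ i, PatternFree μ X Y i i)
    (hP : ∀ e ∈ E, PatternFree μ X Y e.1 e.2) :
    condEntropy μ X Y E =
        ∑ i, r μ Y i * H μ X Y i - ∑ e ∈ E, r₂ μ Y e.1 e.2 * I μ X Y e.1 e.2 ∧
    ∃ C : ℝ, ∀ n : ℕ, 1 ≤ n →
      (∫ ω, descriptionLength (frame X n ω) (E' n (frame X n ω)) ∂μ) / n - condEntropy μ X Y E ≤
        ∑ i, ((α i : ℝ) - 1) / (2 * n) * ∫ ω, Real.log ((obs (frame X n ω) i).card : ℝ) ∂μ +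
        ∑ e ∈ E, (((α e.1 : ℝ) - 1) * ((α e.2 : ℝ) - 1)) / (2 * n) *
          ∫ ω, Real.log ((obs₂ (frame X n ω) e.1 e.2).card : ℝ) ∂μ +
        C / n := by
  have hent := condEntropy_eq hXY hE.isForest hV hP
  refine ⟨hent, ?_⟩
  obtain ⟨C, hC⟩ := exists_integral_descriptionLength_le hα hXY hE.isForest hE' hV hP
  refine ⟨C, fun n hn => ?_⟩
  have hpos : (0 : ℝ) < n := by exact_mod_cast hn
  have h1 := div_le_div_of_nonneg_right (hC n hn) hpos.le
  rw [← hent, add_div, add_div, add_div, mul_div_cancel_left₀ _ hpos.ne', Finset.sum_div,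
    Finset.sum_div] at h1
  have e1 : ∀ a b : ℝ, a / 2 * b / n = a / (2 * n) * b := fun a b => by field_simp
  simp only [e1] at h1
  linarith
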